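/- Let $V\in C^\infty(\mathbb R;\mathbb R)$ with $V=V_{\rm per}+V_{\rm def}$, where $V_{\rm per}(x+1)=V_{\rm per}(x)$ for all $x$ and $V_{\rm def}(x)=0$ for $|x|>\rho$ ($\rho\ge 0$); no parity symmetry is assumed. Suppose $H=-\partial_x^2+V$ has a bound state $0\ne\Phi\in L^2(\mathbb R)$, $H\Phi=E\Phi$ with $E>0$, normalized so that $\Phi(0)=1$ if $\Phi(0)\neq0$ and $\Phi'(0)=1$ if $\Phi(0)=0$. For $\vec\zeta=(w,z)\in\mathbb C^2$ let $u_{\vec\zeta},v_{\vec\zeta}$ be the solutions of $-f''+Vf=zf$ with $$\big(u_{\vec\zeta}(0),u_{\vec\zeta}'(0)\big)=(1,w),\qquad \big(v_{\vec\zeta}(0),v_{\vec\zeta}'(0)\big)=\Big(\tfrac{-w}{1+w^2},\tfrac{1}{1+w^2}\Big)\qquad\text{if }\Phi(0)\ne0,$$ $$\big(u_{\vec\zeta}(0),u_{\vec\zeta}'(0)\big)=(-w,1),\qquad \big(v_{\vec\zeta}(0),v_{\vec\zeta}'(0)\big)=\Big(\tfrac{-1}{1+w^2},\tfrac{-w}{1+w^2}\Big)\qquad\text{if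 }\Phi(0)=0.$$ Put $\vec\eta=(w_0,E)$, where $w_0=\Phi'(0)$ if $\Phi(0)\neq 0$ and $w_0=0$ if $\Phi(0)=0$. Let $\sqrt{\cdot}$ be the principal square root, and for $M>0$ let $$\Theta^\pm(\vec\zeta)=u_{\vec\zeta}'(\pm M)\mp i\sqrt z\,u_{\vec\zeta}(\pm M),\qquad \vec\Theta=(\Theta^+,\Theta^-).$$ Write $A_\pm=v_{\vec\eta}'(\pm M)\mp i\sqrt E\,v_{\vec\eta}(\pm M)$ and $B_\pm=u_{\vec\eta}'(\pm M)\mp i\sqrt E\,u_{\vec\eta}(\pm M)$. Then the larger in modulus of the characteristic (Floquet) multipliers of $-y''+V_{\rm per}y=Ey$ has modulus $e^{\kappa}$ with $\kappa>0$, and for every $0<k\le\kappa$ there are $M_0>\rho$ and $C>0$ such that for all $M\ge M_0$ the following holds. The quantity $A_+A_-\int_{-M}^{M}u_{\vec\eta}^2\,dy$ is nonzero. The function $\vec\Theta$ has exactly one root $\vec\zeta^*=(w^*,z^*)$ in the ball $\{\vec\zeta\in\mathbb C^2:|\vec\zeta-\vec\eta|\le M^{-2}e^{-kM}\}$. The number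 $z^*$ is a resonance of $H_{\rm trunc}=-\partial_x^2+V\mathbf 1_{[-M,M]}$, that is, $\operatorname{Re}z^*>0$, $\operatorname{Im}z^*<0$, and $H_{\rm trunc}\psi=z^*\psi$ has a nonzero $C^1$ solution equal to a multiple of $e^{i\sqrt{z^*}x}$ for $x\ge M$ and to a multiple of $e^{-i\sqrt{z^*}x}$ for $x\le -M$. Finally $$w^*=w_0-\frac{A_-B_+\int_{-M}^0u_{\vec\eta}^2\,dy+A_+B_-\int_0^Mu_{\vec\eta}^2\,dy}{A_+A_-\int_{-M}^Mu_{\vec\eta}^2\,dy}+R_w,\qquad z^*=E-\frac{A_+B_--A_-B_+}{A_+A_-\int_{-M}^Mu_{\vec\eta}^2\,dy}+R_z,$$ where $|R_w|,|R_z|\le C\,M e^{-4\kappa M}$; and if $k<\kappa$, also $|R_w|,|R_z|\le C e^{-4kM}$, that is, the remainders are $O(e^{-4kM})$. -/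

import Mathlib

open MeasureTheory
open scoped ContDiff

noncomputable section

/-- `f` is a (classical) solution on the whole line of `(D_x² + V(x) - z) f = 0`, where
`D_x² = -d²/dx²`, i.e. of `f'' = (V - z) f`. -/
def IsSchrodingerSolution (V : ℝ → ℝ) (z : ℂ) (f : ℝ → ℂ) : Prop :=
  Differentiable ℝ f ∧ ∀ x : ℝ, HasDerivAt (deriv f) (((V x : ℂ) - z) * f x) x

/-- `Φ` is a bound state of `H = D_x² + V` with eigenvalue `E`: a nonzero square-integrable
function with `H Φ = E Φ`. -/
def IsBoundState (V : ℝ → ℝ) (E : ℝ) (Φ : ℝ → ℂ) : Prop :=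
  Φ ≠ 0 ∧ MemLp Φ 2 (volume : Measure ℝ) ∧ IsSchrodingerSolution V (E : ℂ) Φ

/-- `κ > 0` is the logarithm of the modulus of the larger characteristic (Floquet) multiplier of
the `1`-periodic equation `-y'' + Vper y = E y`. The two multipliers have product `1`, so there is
at most one such `κ`. -/
def IsFloquetExponent (Vper : ℝ → ℝ) (E κ : ℝ) : Prop :=
  0 < κ ∧ ∃ (mult : ℂ) (y : ℝ → ℂ), ‖mult‖ = Real.exp κ ∧ y ≠ 0 ∧
    IsSchrodingerSolution Vper (E : ℂ) y ∧ ∀ x : ℝ, y (x + 1) = mult * y x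

/-- The solution `f` of `(D_x² + V(x) - z) f = 0`, `f(0) = a`, `f'(0) = b`
(for continuous `V` it exists and is unique). -/
def ivpSolution (V : ℝ → ℝ) (z a b : ℂ) : ℝ → ℂ :=
  Classical.epsilon fun f : ℝ → ℂ => IsSchrodingerSolution V z f ∧ f 0 = a ∧ deriv f 0 = b

open Classical in
/-- `u_ζ` for `ζ = (w, z)`: the initial data are `(1, w)` when `Φ(0) ≠ 0` and `(-w, 1)` when
`Φ(0) = 0`. -/
def uSol (V : ℝ → ℝ) (Φ : ℝ → ℂ) (ζ : ℂ × ℂ) : ℝ → ℂ :=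
  if Φ 0 ≠ 0 then ivpSolution V ζ.2 1 ζ.1 else ivpSolution V ζ.2 (-ζ.1) 1

open Classical in
/-- `v_ζ` for `ζ = (w, z)`: the initial data are `(-w/(1+w²), 1/(1+w²))` when `Φ(0) ≠ 0` and
`(-1/(1+w²), -w/(1+w²))` when `Φ(0) = 0`. -/
def vSol (V : ℝ → ℝ) (Φ : ℝ → ℂ) (ζ : ℂ × ℂ) : ℝ → ℂ :=
  if Φ 0 ≠ 0 then ivpSolution V ζ.2 (-ζ.1 / (1 + ζ.1 ^ 2)) (1 / (1 + ζ.1 ^ 2))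
  else ivpSolution V ζ.2 (-1 / (1 + ζ.1 ^ 2)) (-ζ.1 / (1 + ζ.1 ^ 2))

open Classical in
/-- `w₀ = Φ'(0)` when `Φ(0) ≠ 0` and `w₀ = 0` when `Φ(0) = 0`. -/
def wZero (Φ : ℝ → ℂ) : ℂ := if Φ 0 ≠ 0 then deriv Φ 0 else 0

/-- `η = (w₀, E)`. -/
def etaVec (Φ : ℝ → ℂ) (E : ℝ) : ℂ × ℂ := (wZero Φ, (E : ℂ))

/-- The principal branch of the square root: `±Im z > 0` implies `±Im √z > 0`. -/
def csqrt (z : ℂ) : ℂ := z ^ (1 / 2 : ℂ)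

/-- `f'(M) - i √z f(M)`. -/
def outPlus (z : ℂ) (f : ℝ → ℂ) (M : ℝ) : ℂ := deriv f M - Complex.I * csqrt z * f M

/-- `f'(-M) + i √z f(-M)`. -/
def outMinus (z : ℂ) (f : ℝ → ℂ) (M : ℝ) : ℂ := deriv f (-M) + Complex.I * csqrt z * f (-M)

/-- `Θ(ζ) = (Θ⁺(ζ), Θ⁻(ζ))`, with `Θ^±(ζ) = u_ζ'(±M) ∓ i √z u_ζ(±M)`, `ζ = (w, z)`. -/
def Theta (V : ℝ → ℝ) (Φ : ℝ → ℂ) (M : ℝ) (ζ : ℂ × ℂ) : ℂ × ℂ :=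
  (outPlus ζ.2 (uSol V Φ ζ) M, outMinus ζ.2 (uSol V Φ ζ) M)

/-- The closed ball `Ω_M` of radius `e^{-kM} / M²` about `η`, for the Euclidean norm of `ℂ²`. -/
def OmegaBall (Φ : ℝ → ℂ) (E k M : ℝ) : Set (ℂ × ℂ) :=
  {ζ | Real.sqrt (‖ζ.1 - (etaVec Φ E).1‖ ^ 2 + ‖ζ.2 - (etaVec Φ E).2‖ ^ 2)
    ≤ 1 / M ^ 2 * Real.exp (-(k * M))}

open Classical in
/-- The truncated potential: `V` on `[-M, M]`, and `0` outside. -/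
def Vtrunc (V : ℝ → ℝ) (M : ℝ) (x : ℝ) : ℝ := if |x| ≤ M then V x else 0

/-- `z` is a resonance of `H_trunc = D_x² + V_trunc`: `Re z > 0`, `Im z < 0`, and
`H_trunc ψ = z ψ` has a nonzero outgoing solution (`C¹` across the jumps of `V_trunc`). -/
def IsResonance (V : ℝ → ℝ) (M : ℝ) (z : ℂ) : Prop :=
  0 < z.re ∧ z.im < 0 ∧ ∃ ψ : ℝ → ℂ, ψ ≠ 0 ∧ ContDiff ℝ 1 ψ ∧
    (∀ x : ℝ, |x| ≠ M → HasDerivAt (deriv ψ) (((Vtrunc V M x : ℂ) - z) * ψ x) x) ∧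
    (∃ c : ℂ, ∀ x : ℝ, M ≤ x → ψ x = c * Complex.exp (Complex.I * csqrt z * x)) ∧
    (∃ c : ℂ, ∀ x : ℝ, x ≤ -M → ψ x = c * Complex.exp (-(Complex.I * csqrt z * x)))

/-- `∫_a^b u_η(y)² dy`. -/
def uSqInt (V : ℝ → ℝ) (Φ : ℝ → ℂ) (E a b : ℝ) : ℂ :=
  ∫ y in a..b, uSol V Φ (etaVec Φ E) y ^ 2

/-- The common denominator of the two correction terms,
`∫_{-M}^M u_η² · (v_η'(M) - i√E v_η(M)) · (v_η'(-M) + i√E v_η(-M))`. -/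
def corrDenom (V : ℝ → ℝ) (Φ : ℝ → ℂ) (E M : ℝ) : ℂ :=
  uSqInt V Φ E (-M) M * outPlus E (vSol V Φ (etaVec Φ E)) M * outMinus E (vSol V Φ (etaVec Φ E)) M

/-- The explicit approximation of `w*`. -/
def wApprox (V : ℝ → ℝ) (Φ : ℝ → ℂ) (E M : ℝ) : ℂ :=
  wZero Φ -
    (uSqInt V Φ E (-M) 0 * outMinus E (vSol V Φ (etaVec Φ E)) M
        * outPlus E (uSol V Φ (etaVec Φ E)) M
      + uSqInt V Φ E 0 M * outPlus E (vSol V Φ (etaVec Φ E)) M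
        * outMinus E (uSol V Φ (etaVec Φ E)) M)
    / corrDenom V Φ E M

/-- The explicit approximation of `z*`. -/
def zApprox (V : ℝ → ℝ) (Φ : ℝ → ℂ) (E M : ℝ) : ℂ :=
  (E : ℂ) -
    (outPlus E (vSol V Φ (etaVec Φ E)) M * outMinus E (uSol V Φ (etaVec Φ E)) M
      - outMinus E (vSol V Φ (etaVec Φ E)) M * outPlus E (uSol V Φ (etaVec Φ E)) M)
    / corrDenom V Φ E M

end

/-!
By Floquet theory a bound state at energy `E` forces the multipliers of the periodic equation to
have moduli `exp (±κ)` with `κ > 0`, and `u_η = Φ` decays like `exp (-κ |x|)` while `v_η` grows at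
most like `exp (κ |x|)`. Since `v_η` is real-valued with unit Wronskian against `u_η`, the
coefficients `A±` are of exact order `exp (κ M)`, whereas `Θ(η) = (B₊, B₋)` is `O(exp (-κ M))`.

Variation of parameters with respect to `u_η, v_η` shows that, near `η`, the map `Θ` differs from
the affine map with linear part `(w, z) ↦ (A₊ (w - z ∫₀ᴹ u_η²), A₋ (w + z ∫₋ᴹ⁰ u_η²))` by a function
whose Lipschitz constant on a ball of radius `r` is `O(M (exp (-κ M) + r exp (κ M)))`. The
determinant of the linear part is `A₊ A₋ ∫ u_η²` and its inverse has norm `O(exp (-κ M))`, so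
Newton's method with this fixed inverse is a contraction on the ball `Ω_M`. Its first step gives the
explicit approximation at distance `O(exp (-2 κ M))` from `η`, and the contraction estimate with
`r = O(exp (-2 κ M))` bounds what remains by `O(M exp (-4 κ M))`.

At a zero of `Θ` the restriction of `u_ζ` to `[-M, M]` extends to an outgoing solution. Its outward
flux `Re √z (|u_ζ(M)|² + |u_ζ(-M)|²)` is positive and equals `-Im z ∫ |u_ζ|²`, so `Im z < 0`.
-/

/-! ### Linear differential equations -/

section LinearODE

open BoundedContinuousFunction

variable {F : Type*} [NormedAddCommGroup F] [NormedSpace ℝ F]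

theorem integral_mul_exp_two_mul_primitive {m : ℝ → ℝ} (hm : Continuous m) (x : ℝ) :
    ∫ t in 0..x, m t * Real.exp (2 * ∫ s in 0..t, m s)
      = (Real.exp (2 * ∫ s in 0..x, m s) - 1) / 2 := by
  have hprimitive : ∀ t, HasDerivAt (fun t => ∫ s in 0..t, m s) (m t) t :=
    fun t => (hm.integral_hasStrictDerivAt 0 t).hasDerivAt
  have : Continuous fun t => ∫ s in 0..t, m s :=
    continuous_iff_continuousAt.2 fun t => (hprimitive t).continuousAt
  rw [intervalIntegral.integral_eq_sub_of_hasDerivAt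
    (f := fun t => Real.exp (2 * ∫ s in 0..t, m s) / 2)
    (fun t _ => (((hprimitive t).const_mul 2).exp.div_const 2).congr_deriv (by ring))
    (Continuous.intervalIntegrable (by fun_prop) _ _)]
  simp only [intervalIntegral.integral_same, mul_zero, Real.exp_zero]
  ring

theorem norm_integral_le_exp_abs_primitive {m : ℝ → ℝ} (hm : Continuous m) (hm₀ : 0 ≤ m)
    {f : ℝ → F} {c : ℝ} (hc : 0 ≤ c)
    (hf : ∀ t, ‖f t‖ ≤ c * (m t * Real.exp (2 * |∫ s in 0..t, m s|))) (x : ℝ) :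
    ‖∫ t in 0..x, f t‖ ≤ c / 2 * Real.exp (2 * |∫ s in 0..x, m s|) := by
  wlog hx : 0 ≤ x generalizing m f x
  · have hneg : ∀ t, ∫ s in 0..t, m (-s) = -∫ s in 0..-t, m s := fun t => by
      rw [intervalIntegral.integral_comp_neg, neg_zero, intervalIntegral.integral_symm]
    have h := this (m := fun s => m (-s)) (f := fun t => f (-t)) (by fun_prop) (fun t => hm₀ (-t))
      (fun t => by simpa only [hneg, abs_neg] using hf (-t)) (-x) (by linarith)
    simpa [hneg, intervalIntegral.integral_comp_neg, intervalIntegral.integral_symm x 0] using h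
  have habs : ∀ t, 0 ≤ t → |∫ s in 0..t, m s| = ∫ s in 0..t, m s := fun t ht =>
    abs_of_nonneg (intervalIntegral.integral_nonneg ht fun s _ => hm₀ s)
  have : Continuous fun t => ∫ s in 0..t, m s :=
    intervalIntegral.continuous_primitive (fun _ _ => hm.intervalIntegrable _ _) 0
  calc ‖∫ t in 0..x, f t‖ ≤ ∫ t in 0..x, c * (m t * Real.exp (2 * ∫ s in 0..t, m s)) := by
        refine intervalIntegral.norm_integral_le_of_norm_le hx
          (Filter.Eventually.of_forall fun t ht => ?_)
          (Continuous.intervalIntegrable (by fun_prop) _ _)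
        simpa only [habs t ht.1.le] using hf t
    _ = c / 2 * (Real.exp (2 * |∫ s in 0..x, m s|) - 1) := by
        rw [intervalIntegral.integral_const_mul, integral_mul_exp_two_mul_primitive hm, habs x hx]
        ring
    _ ≤ c / 2 * Real.exp (2 * |∫ s in 0..x, m s|) := by gcongr; linarith

variable {A : ℝ → F →L[ℝ] F}

/-- The weight in which the Volterra operator `y ↦ ∫₀ˣ A y` has norm at most `1 / 2`. -/
noncomputable def volterraWeight (A : ℝ → F →L[ℝ] F) (x : ℝ) : ℝ :=
  Real.exp (2 * |∫ t in 0..x, ‖A t‖|)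

theorem volterraWeight_pos (A : ℝ → F →L[ℝ] F) (x : ℝ) : 0 < volterraWeight A x := Real.exp_pos _

theorem norm_inv_volterraWeight_le_one (A : ℝ → F →L[ℝ] F) (x : ℝ) :
    ‖(volterraWeight A x)⁻¹‖ ≤ 1 := by
  rw [norm_inv, Real.norm_of_nonneg (volterraWeight_pos A x).le]
  exact inv_le_one_of_one_le₀ (Real.one_le_exp (by positivity))

theorem continuous_volterraWeight (hA : Continuous A) : Continuous (volterraWeight A) := by
  have := intervalIntegral.continuous_primitive
    (fun a b => hA.norm.intervalIntegrable (μ := volume) a b) 0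
  unfold volterraWeight
  fun_prop

theorem continuous_volterraWeight_smul (hA : Continuous A) (g : ℝ →ᵇ F) :
    Continuous fun t => volterraWeight A t • A t (g t) := by
  have := g.continuous
  have := continuous_volterraWeight hA
  fun_prop

theorem norm_inv_volterraWeight_smul_integral_le (hA : Continuous A) (g : ℝ →ᵇ F) (x : ℝ) :
    ‖(volterraWeight A x)⁻¹ • ∫ t in 0..x, volterraWeight A t • A t (g t)‖ ≤ 1 / 2 * ‖g‖ := by
  have hbound : ∀ t, ‖volterraWeight A t • A t (g t)‖
      ≤ ‖g‖ * (‖A t‖ * Real.exp (2 * |∫ s in 0..t, ‖A s‖|)) := fun t => by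
    rw [norm_smul, Real.norm_of_nonneg (volterraWeight_pos A t).le, volterraWeight]
    calc _ ≤ Real.exp (2 * |∫ s in 0..t, ‖A s‖|) * (‖A t‖ * ‖g‖) := by
          gcongr
          exact (A t).le_opNorm_of_le (g.norm_coe_le_norm t)
      _ = _ := by ring
  have h := norm_integral_le_exp_abs_primitive hA.norm (fun t => norm_nonneg (A t))
    (norm_nonneg g) hbound x
  rw [norm_smul, norm_inv, Real.norm_of_nonneg (volterraWeight_pos A x).le,
    inv_mul_le_iff₀ (volterraWeight_pos A x)]
  exact h.trans_eq (by rw [volterraWeight]; ring)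

/-- The Volterra operator `y ↦ ∫₀ˣ A y`, conjugated by `volterraWeight A`. -/
noncomputable def weightedVolterra (hA : Continuous A) : (ℝ →ᵇ F) →L[ℝ] (ℝ →ᵇ F) :=
  LinearMap.mkContinuous
    { toFun := fun g => ofNormedAddCommGroup
        (fun x => (volterraWeight A x)⁻¹ • ∫ t in 0..x, volterraWeight A t • A t (g t))
        (((continuous_volterraWeight hA).inv₀ fun x => (volterraWeight_pos A x).ne').smul
          (intervalIntegral.continuous_primitive
            (fun _ _ => (continuous_volterraWeight_smul hA g).intervalIntegrable _ _) 0))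
        (1 / 2 * ‖g‖) (norm_inv_volterraWeight_smul_integral_le hA g)
      map_add' := fun g h => by
        ext x
        have := intervalIntegral.integral_add (μ := volume) (a := 0) (b := x)
          ((continuous_volterraWeight_smul hA g).intervalIntegrable 0 x)
          ((continuous_volterraWeight_smul hA h).intervalIntegrable 0 x)
        simp [this, smul_add]
      map_smul' := fun c g => by
        ext x
        simp [smul_comm _ c] }
    (1 / 2) fun g => norm_ofNormedAddCommGroup_le _ (by positivity)
      (norm_inv_volterraWeight_smul_integral_le hA g)

theorem weightedVolterra_apply (hA : Continuous A) (g : ℝ →ᵇ F) (x : ℝ) :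
    weightedVolterra hA g x
      = (volterraWeight A x)⁻¹ • ∫ t in 0..x, volterraWeight A t • A t (g t) := rfl

theorem norm_weightedVolterra_lt_one (hA : Continuous A) : ‖weightedVolterra hA‖ < 1 :=
  (LinearMap.mkContinuous_norm_le _ (by norm_num) _).trans_lt (by norm_num)

variable [CompleteSpace F]

theorem exists_continuous_eq_add_integral (hA : Continuous A) (y₀ : F) :
    ∃ y : ℝ → F, Continuous y ∧ ∀ x, y x = y₀ + ∫ t in 0..x, A t (y t) := by
  have hwc := continuous_volterraWeight hA
  have hw₀ : ∀ x, volterraWeight A x ≠ 0 := fun x => (volterraWeight_pos A x).ne'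
  let h : ℝ →ᵇ F := ofNormedAddCommGroup (fun x => (volterraWeight A x)⁻¹ • y₀)
    ((hwc.inv₀ hw₀).smul continuous_const) (1 * ‖y₀‖) fun x => by
      rw [norm_smul]
      gcongr
      exact norm_inv_volterraWeight_le_one A x
  obtain ⟨S, hS⟩ := isUnit_one_sub_of_norm_lt_one (norm_weightedVolterra_lt_one hA)
  have hSh : ((1 : (ℝ →ᵇ F) →L[ℝ] (ℝ →ᵇ F)) - weightedVolterra hA) ((↑S⁻¹ : _ →L[ℝ] _) h) = h := by
    rw [← hS, ← mul_apply_eq_comp, S.mul_inv, one_apply_eq_self]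
  set g : ℝ →ᵇ F := (↑S⁻¹ : _ →L[ℝ] _) h
  refine ⟨fun x => volterraWeight A x • g x, hwc.smul g.continuous, fun x => ?_⟩
  have hx : g x - weightedVolterra hA g x = (volterraWeight A x)⁻¹ • y₀ :=
    congrArg (fun k : ℝ →ᵇ F => k x) hSh
  rw [weightedVolterra_apply, sub_eq_iff_eq_add, ← smul_add] at hx
  simp only [hx, smul_inv_smul₀ (hw₀ x), map_smul]

theorem exists_hasDerivAt_linear (hA : Continuous A) (t₀ : ℝ) (y₀ : F) :
    ∃ y : ℝ → F, y t₀ = y₀ ∧ ∀ t, HasDerivAt y (A t (y t)) t := by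
  obtain ⟨y, hyc, hy⟩ := exists_continuous_eq_add_integral
    (A := fun t => A (t + t₀)) (by fun_prop) y₀
  have hderiv : ∀ t, HasDerivAt y (A (t + t₀) (y t)) t := fun t => by
    have hc : Continuous fun t => A (t + t₀) (y t) := by fun_prop
    rw [funext hy]
    simpa only [← hy] using ((hc.integral_hasStrictDerivAt 0 t).hasDerivAt).const_add y₀
  refine ⟨fun t => y (t - t₀), by simp [hy 0], fun t => ?_⟩
  simpa using (hderiv (t - t₀)).comp_sub_const t t₀

end LinearODE

/-! ### Solutions of the Schrödinger equation -/

/-- The Wronskian `f g' - f' g`. -/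
noncomputable def wronskian (f g : ℝ → ℂ) (x : ℝ) : ℂ := f x * deriv g x - deriv f x * g x

/-- The Cauchy data `(f x, f' x)` of a function at a point. -/
noncomputable def cauchyData (f : ℝ → ℂ) (x : ℝ) : ℂ × ℂ := (f x, deriv f x)

theorem norm_apply_le_norm_cauchyData (f : ℝ → ℂ) (x : ℝ) : ‖f x‖ ≤ ‖cauchyData f x‖ :=
  norm_fst_le (cauchyData f x)

theorem norm_deriv_le_norm_cauchyData (f : ℝ → ℂ) (x : ℝ) : ‖deriv f x‖ ≤ ‖cauchyData f x‖ :=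
  norm_snd_le (cauchyData f x)

theorem norm_wronskian_le (f g : ℝ → ℂ) (x : ℝ) :
    ‖wronskian f g x‖ ≤ 2 * ‖cauchyData f x‖ * ‖cauchyData g x‖ :=
  calc ‖wronskian f g x‖ ≤ ‖f x‖ * ‖deriv g x‖ + ‖deriv f x‖ * ‖g x‖ := by
        rw [← norm_mul, ← norm_mul]
        exact norm_sub_le _ _
    _ ≤ ‖cauchyData f x‖ * ‖cauchyData g x‖ + ‖cauchyData f x‖ * ‖cauchyData g x‖ := by
        gcongr
        exacts [norm_apply_le_norm_cauchyData f x, norm_deriv_le_norm_cauchyData g x,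
          norm_deriv_le_norm_cauchyData f x, norm_apply_le_norm_cauchyData g x]
    _ = _ := by ring

theorem cauchyData_congr {f g : ℝ → ℂ} {x : ℝ} (h : f =ᶠ[nhds x] g) :
    cauchyData f x = cauchyData g x := by
  rw [cauchyData, cauchyData, h.eq_of_nhds, h.deriv_eq]

theorem cauchyData_comp_neg (f : ℝ → ℂ) (x : ℝ) :
    cauchyData (fun t => f (-t)) x = (f (-x), -deriv f (-x)) := by
  rw [cauchyData, deriv_comp_neg]

theorem norm_cauchyData_comp_neg (f : ℝ → ℂ) (x : ℝ) :
    ‖cauchyData (fun t => f (-t)) x‖ = ‖cauchyData f (-x)‖ := by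
  rw [cauchyData_comp_neg, Prod.norm_mk, norm_neg, cauchyData, Prod.norm_mk]

theorem cauchyData_comp_add_const (f : ℝ → ℂ) (c x : ℝ) :
    cauchyData (fun t => f (t + c)) x = cauchyData f (x + c) := by
  rw [cauchyData, deriv_comp_add_const, cauchyData]

theorem cauchyData_eq_wronskian_smul {u v : ℝ → ℂ} {x : ℝ} (huv : wronskian u v x = 1)
    (f : ℝ → ℂ) : cauchyData f x
      = wronskian f v x • cauchyData u x + wronskian u f x • cauchyData v x := by
  simp only [wronskian, cauchyData] at huv ⊢
  ext
  · simp only [Prod.smul_mk, Prod.mk_add_mk, smul_eq_mul]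
    linear_combination (-f x) * huv
  · simp only [Prod.smul_mk, Prod.mk_add_mk, smul_eq_mul]
    linear_combination (-deriv f x) * huv

namespace IsSchrodingerSolution

variable {V W : ℝ → ℝ} {z z₁ z₂ : ℂ} {f g : ℝ → ℂ}

theorem hasDerivAt (hf : IsSchrodingerSolution V z f) (x : ℝ) : HasDerivAt f (deriv f x) x :=
  (hf.1 x).hasDerivAt

theorem continuous (hf : IsSchrodingerSolution V z f) : Continuous f := hf.1.continuous

theorem continuous_deriv (hf : IsSchrodingerSolution V z f) : Continuous (deriv f) :=
  continuous_iff_continuousAt.2 fun x => (hf.2 x).continuousAt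

theorem continuous_cauchyData (hf : IsSchrodingerSolution V z f) : Continuous (cauchyData f) :=
  hf.continuous.prodMk hf.continuous_deriv

theorem of_hasDerivAt {f' : ℝ → ℂ} (hf : ∀ x, HasDerivAt f (f' x) x)
    (hf' : ∀ x, HasDerivAt f' (((V x : ℂ) - z) * f x) x) : IsSchrodingerSolution V z f := by
  refine ⟨fun x => (hf x).differentiableAt, ?_⟩
  rwa [show deriv f = f' from funext fun x => (hf x).deriv]

theorem zero (V : ℝ → ℝ) (z : ℂ) : IsSchrodingerSolution V z 0 :=
  of_hasDerivAt (fun x => hasDerivAt_const x 0)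
    fun x => (hasDerivAt_const x 0).congr_deriv (by simp)

theorem linearCombination (hf : IsSchrodingerSolution V z f) (hg : IsSchrodingerSolution V z g)
    (a b : ℂ) : IsSchrodingerSolution V z fun x => a * f x + b * g x :=
  of_hasDerivAt (fun x => ((hf.hasDerivAt x).const_mul a).add ((hg.hasDerivAt x).const_mul b))
    fun x => (((hf.2 x).const_mul a).add ((hg.2 x).const_mul b)).congr_deriv (by ring)

theorem cauchyData_linearCombination (hf : IsSchrodingerSolution V z₁ f)
    (hg : IsSchrodingerSolution W z₂ g) (a b : ℂ) (x : ℝ) :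
    cauchyData (fun t => a * f t + b * g t) x = a • cauchyData f x + b • cauchyData g x := by
  have h := (((hf.hasDerivAt x).const_mul a).add ((hg.hasDerivAt x).const_mul b)).deriv
  simp only [cauchyData, Prod.smul_mk, Prod.mk_add_mk, smul_eq_mul]
  exact Prod.ext rfl h

theorem comp_neg (hf : IsSchrodingerSolution V z f) :
    IsSchrodingerSolution (fun x => V (-x)) z fun x => f (-x) :=
  of_hasDerivAt
    (fun x => ((hf.hasDerivAt (-x)).scomp x (hasDerivAt_neg x)).congr_deriv (by simp))
    fun x => ((hf.2 (-x)).scomp x (hasDerivAt_neg x)).neg.congr_deriv (by simp)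

theorem comp_add_const (hf : IsSchrodingerSolution V z f) {c : ℝ} (hV : Function.Periodic V c) :
    IsSchrodingerSolution V z fun x => f (x + c) :=
  of_hasDerivAt (fun x => (hf.hasDerivAt (x + c)).comp_add_const x c) fun x =>
    ((hf.2 (x + c)).comp_add_const x c).congr_deriv (by rw [hV x])

theorem conj (hf : IsSchrodingerSolution V z f) :
    IsSchrodingerSolution V (starRingEnd ℂ z) fun x => starRingEnd ℂ (f x) :=
  of_hasDerivAt (fun x => (hf.hasDerivAt x).star) fun x => (hf.2 x).star.congr_deriv (by simp)

theorem deriv_conj (hf : IsSchrodingerSolution V z f) (x : ℝ) :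
    deriv (fun t => starRingEnd ℂ (f t)) x = starRingEnd ℂ (deriv f x) :=
  (hf.hasDerivAt x).star.deriv

theorem cauchyData_conj (hf : IsSchrodingerSolution V z f) (x : ℝ) :
    cauchyData (fun t => starRingEnd ℂ (f t)) x = star (cauchyData f x) :=
  Prod.ext rfl (hf.deriv_conj x)

theorem hasDerivAt_wronskian (hf : IsSchrodingerSolution V z₁ f)
    (hg : IsSchrodingerSolution W z₂ g) (x : ℝ) :
    HasDerivAt (wronskian f g) ((W x - V x + (z₁ - z₂)) * (f x * g x)) x :=
  (((hf.hasDerivAt x).mul (hg.2 x)).sub ((hf.2 x).mul (hg.hasDerivAt x))).congr_deriv (by ring)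

theorem wronskian_sub (hf : IsSchrodingerSolution V z₁ f) (hg : IsSchrodingerSolution V z₂ g)
    (x y : ℝ) :
    wronskian f g y - wronskian f g x = (z₁ - z₂) * ∫ t in x..y, f t * g t := by
  have := hf.continuous
  have := hg.continuous
  rw [← intervalIntegral.integral_const_mul]
  exact (intervalIntegral.integral_eq_sub_of_hasDerivAt
    (fun t _ => (hf.hasDerivAt_wronskian hg t).congr_deriv (by ring))
    (Continuous.intervalIntegrable (by fun_prop) _ _)).symm

theorem wronskian_eq_of_eqOn (hf : IsSchrodingerSolution V z f)
    (hg : IsSchrodingerSolution W z g) {x y : ℝ} (hVW : Set.EqOn V W (Set.uIcc x y)) :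
    wronskian f g y = wronskian f g x := by
  have h := intervalIntegral.integral_eq_sub_of_hasDerivAt (a := x) (b := y) (f' := fun _ => 0)
    (fun t ht => (hf.hasDerivAt_wronskian hg t).congr_deriv (by simp [hVW ht])) (by simp)
  simpa [eq_comm, sub_eq_zero] using h

theorem wronskian_eq (hf : IsSchrodingerSolution V z f) (hg : IsSchrodingerSolution V z g)
    (x y : ℝ) : wronskian f g y = wronskian f g x :=
  hf.wronskian_eq_of_eqOn hg (Set.eqOn_refl _ _)

end IsSchrodingerSolution

section InitialValueProblem

variable {V W : ℝ → ℝ} {z : ℂ} {f g : ℝ → ℂ}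

theorem exists_isSchrodingerSolution (hV : Continuous V) (z : ℂ) (x₀ : ℝ) (p : ℂ × ℂ) :
    ∃ f, IsSchrodingerSolution V z f ∧ cauchyData f x₀ = p := by
  let fst := ContinuousLinearMap.fst ℝ ℂ ℂ
  let snd := ContinuousLinearMap.snd ℝ ℂ ℂ
  let inl := ContinuousLinearMap.inl ℝ ℂ ℂ
  let inr := ContinuousLinearMap.inr ℝ ℂ ℂ
  obtain ⟨y, hy₀, hy⟩ := exists_hasDerivAt_linear
    (A := fun x => inl ∘L snd + ((V x : ℂ) - z) • (inr ∘L fst)) (by fun_prop) x₀ p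
  have hy' : ∀ x, HasDerivAt y ((y x).2, ((V x : ℂ) - z) * (y x).1) x := fun x => by
    simpa [inl, inr, fst, snd] using hy x
  have hfst : ∀ x, HasDerivAt (fun t => (y t).1) (y x).2 x := fun x => (hy' x).fst
  refine ⟨fun t => (y t).1, .of_hasDerivAt hfst fun x => (hy' x).snd, ?_⟩
  rw [cauchyData, (hfst x₀).deriv, hy₀]

theorem IsSchrodingerSolution.eqOn_cauchyData (hW : Continuous W)
    (hf : IsSchrodingerSolution V z f) (hg : IsSchrodingerSolution W z g) {s : Set ℝ}
    (hs : s.OrdConnected) (hVW : Set.EqOn V W s) {x₀ : ℝ} (hx₀ : x₀ ∈ s)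
    (hfg : cauchyData f x₀ = cauchyData g x₀) : Set.EqOn (cauchyData f) (cauchyData g) s := by
  obtain ⟨u, hu, hu₀⟩ := exists_isSchrodingerSolution hW z x₀ (1, 0)
  obtain ⟨v, hv, hv₀⟩ := exists_isSchrodingerSolution hW z x₀ (0, 1)
  simp only [cauchyData, Prod.mk.injEq] at hu₀ hv₀ hfg
  intro x hx
  have hVWx : Set.EqOn V W (Set.uIcc x₀ x) := hVW.mono (hs.uIcc_subset hx₀ hx)
  have huv : wronskian u v x = 1 := by
    rw [hu.wronskian_eq hv x₀ x]
    simp [wronskian, hu₀, hv₀]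
  rw [cauchyData_eq_wronskian_smul huv f, cauchyData_eq_wronskian_smul huv g,
    hf.wronskian_eq_of_eqOn hv hVWx, hu.wronskian_eq_of_eqOn hf hVWx.symm,
    hg.wronskian_eq hv x₀, hu.wronskian_eq hg x₀]
  simp only [wronskian, hfg]

theorem IsSchrodingerSolution.eq_of_cauchyData_eq (hV : Continuous V)
    (hf : IsSchrodingerSolution V z f) (hg : IsSchrodingerSolution V z g) {x₀ : ℝ}
    (hfg : cauchyData f x₀ = cauchyData g x₀) : f = g :=
  funext fun x => congrArg Prod.fst
    (hf.eqOn_cauchyData hV hg Set.ordConnected_univ (Set.eqOn_refl _ _) (Set.mem_univ x₀) hfg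
      (Set.mem_univ x))

theorem IsSchrodingerSolution.eq_zero_of_eventually_eq_zero (hV : Continuous V)
    (hf : IsSchrodingerSolution V z f) {x₀ : ℝ} (h : f =ᶠ[nhds x₀] 0) : f = 0 :=
  hf.eq_of_cauchyData_eq hV (.zero V z) (cauchyData_congr h)

theorem ivpSolution_spec (hV : Continuous V) (z a b : ℂ) :
    IsSchrodingerSolution V z (ivpSolution V z a b) ∧
      cauchyData (ivpSolution V z a b) 0 = (a, b) := by
  obtain ⟨f, hf, hab⟩ := exists_isSchrodingerSolution hV z 0 (a, b)
  have h : ∃ f, IsSchrodingerSolution V z f ∧ f 0 = a ∧ deriv f 0 = b :=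
    ⟨f, hf, (Prod.ext_iff.1 hab).1, (Prod.ext_iff.1 hab).2⟩
  have hspec := Classical.epsilon_spec h
  exact ⟨hspec.1, Prod.ext hspec.2.1 hspec.2.2⟩

theorem wronskian_ivpSolution (hV : Continuous V) (z : ℂ) (x : ℝ) :
    wronskian (ivpSolution V z 1 0) (ivpSolution V z 0 1) x = 1 := by
  obtain ⟨hc, hc₀⟩ := ivpSolution_spec hV z 1 0
  obtain ⟨hd, hd₀⟩ := ivpSolution_spec hV z 0 1
  simp only [cauchyData, Prod.mk.injEq] at hc₀ hd₀
  rw [hc.wronskian_eq hd 0]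
  simp [wronskian, hc₀, hd₀]

theorem IsSchrodingerSolution.cauchyData_eq_smul_ivpSolution (hV : Continuous V)
    (hf : IsSchrodingerSolution V z f) (x : ℝ) :
    cauchyData f x = f 0 • cauchyData (ivpSolution V z 1 0) x
      + deriv f 0 • cauchyData (ivpSolution V z 0 1) x := by
  obtain ⟨hc, hc₀⟩ := ivpSolution_spec hV z 1 0
  obtain ⟨hd, hd₀⟩ := ivpSolution_spec hV z 0 1
  simp only [cauchyData, Prod.mk.injEq] at hc₀ hd₀
  rw [cauchyData_eq_wronskian_smul (wronskian_ivpSolution hV z x) f, hf.wronskian_eq hd 0,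
    hc.wronskian_eq hf 0]
  simp [wronskian, hc₀, hd₀]

end InitialValueProblem

/-! ### Floquet theory -/

section Floquet

variable {V W : ℝ → ℝ} {z : ℂ} {f g : ℝ → ℂ}

/-- The trace of the monodromy matrix of the `1`-periodic equation `-y'' + W y = z y`. -/
noncomputable def discriminant (W : ℝ → ℝ) (z : ℂ) : ℂ :=
  ivpSolution W z 1 0 1 + deriv (ivpSolution W z 0 1) 1

namespace IsSchrodingerSolution

theorem cauchyData_add_one (hW : Continuous W) (hper : Function.Periodic W 1)
    (hf : IsSchrodingerSolution W z f) (x : ℝ) :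
    cauchyData f (x + 1) = f 1 • cauchyData (ivpSolution W z 1 0) x
      + deriv f 1 • cauchyData (ivpSolution W z 0 1) x := by
  simpa only [cauchyData_comp_add_const, deriv_comp_add_const, zero_add] using
    (hf.comp_add_const hper).cauchyData_eq_smul_ivpSolution hW x

-- The Cayley-Hamilton identity for the monodromy matrix, whose determinant is a Wronskian.
theorem cauchyData_add_two (hW : Continuous W) (hper : Function.Periodic W 1)
    (hf : IsSchrodingerSolution W z f) (x : ℝ) :
    cauchyData f (x + 2) = discriminant W z • cauchyData f (x + 1) - cauchyData f x := by
  have hdet := wronskian_ivpSolution hW z 1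
  have hone := hf.cauchyData_eq_smul_ivpSolution hW 1
  have htwo := hf.cauchyData_add_one hW hper 1
  rw [one_add_one_eq_two] at htwo
  have hshift := (hf.comp_add_const hper).cauchyData_add_one hW hper x
  rw [cauchyData_comp_add_const, deriv_comp_add_const, add_assoc, one_add_one_eq_two] at hshift
  simp only [cauchyData, wronskian, Prod.smul_mk, Prod.mk_add_mk, smul_eq_mul, Prod.mk.injEq]
    at hdet hone htwo
  have hvalue : f 2 = discriminant W z * f 1 - f 0 := by
    rw [htwo.1, discriminant]
    linear_combination ivpSolution W z 0 1 1 * hone.2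
      - deriv (ivpSolution W z 0 1) 1 * hone.1 - f 0 * hdet
  have hderiv : deriv f 2 = discriminant W z * deriv f 1 - deriv f 0 := by
    rw [htwo.2, discriminant]
    linear_combination deriv (ivpSolution W z 1 0) 1 * hone.1
      - ivpSolution W z 1 0 1 * hone.2 - deriv f 0 * hdet
  rw [hshift, hf.cauchyData_add_one hW hper, hf.cauchyData_eq_smul_ivpSolution hW x, hvalue, hderiv]
  module

theorem cauchyData_add_two_of_eqOn (hW : Continuous W) (hper : Function.Periodic W 1)
    (hf : IsSchrodingerSolution V z f) {x : ℝ} (hVW : Set.EqOn V W (Set.Icc x (x + 2))) :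
    cauchyData f (x + 2) = discriminant W z • cauchyData f (x + 1) - cauchyData f x := by
  obtain ⟨g, hg, hgx⟩ := exists_isSchrodingerSolution hW z x (cauchyData f x)
  have hfg := hf.eqOn_cauchyData hW hg Set.ordConnected_Icc hVW ⟨le_rfl, by linarith⟩ hgx.symm
  rw [hfg ⟨by linarith, le_rfl⟩, hfg (x := x + 1) ⟨by linarith, by linarith⟩, ← hgx]
  exact hg.cauchyData_add_two hW hper x

theorem floquetSolution (hW : Continuous W) (hper : Function.Periodic W 1)
    (hf : IsSchrodingerSolution W z f) {l m : ℂ} (hlm : l * m = 1)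
    (hτ : l + m = discriminant W z) :
    IsSchrodingerSolution W z (fun x => 1 * f (x + 1) + -m * f x) ∧
      ∀ x, 1 * f (x + 1 + 1) + -m * f (x + 1) = l * (1 * f (x + 1) + -m * f x) := by
  refine ⟨(hf.comp_add_const hper).linearCombination hf 1 (-m), fun x => ?_⟩
  have hrec : f (x + 2) = discriminant W z * f (x + 1) - f x :=
    congrArg Prod.fst (hf.cauchyData_add_two hW hper x)
  rw [add_assoc, one_add_one_eq_two, hrec, ← hτ]
  linear_combination f x * hlm

end IsSchrodingerSolution

theorem exists_floquetSolution (hW : Continuous W) (hper : Function.Periodic W 1) {l m : ℂ}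
    (hlm : l * m = 1) (hτ : l + m = discriminant W z) (hne : l ≠ m) :
    ∃ y ≠ 0, IsSchrodingerSolution W z y ∧ ∀ x, y (x + 1) = l * y x := by
  obtain ⟨hc, hc₀⟩ := ivpSolution_spec hW z 1 0
  obtain ⟨hd, hd₀⟩ := ivpSolution_spec hW z 0 1
  have hc' := hc.floquetSolution hW hper hlm hτ
  have hd' := hd.floquetSolution hW hper hlm hτ
  by_contra! hall
  have hczero := not_ne_iff.1 fun h => (hall _ h hc'.1).elim fun x hx => hx (hc'.2 x)
  have hdzero := not_ne_iff.1 fun h => (hall _ h hd'.1).elim fun x hx => hx (hd'.2 x)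
  have hcdata := (hc.comp_add_const hper).cauchyData_linearCombination hc 1 (-m) 0
  have hddata := (hd.comp_add_const hper).cauchyData_linearCombination hd 1 (-m) 0
  rw [hczero, cauchyData_comp_add_const, hc₀] at hcdata
  rw [hdzero, cauchyData_comp_add_const, hd₀] at hddata
  have hcm : ivpSolution W z 1 0 1 = m := by
    simpa [cauchyData, add_neg_eq_zero] using (congrArg Prod.fst hcdata).symm
  have hdm : deriv (ivpSolution W z 0 1) 1 = m := by
    simpa [cauchyData, add_neg_eq_zero] using (congrArg Prod.snd hddata).symm
  refine hne (add_right_cancel (b := m) ?_)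
  rw [hτ, discriminant, hcm, hdm]

theorem norm_eq_exp_neg_of_mul_eq_one {l m : ℂ} {κ : ℝ} (hlm : l * m = 1)
    (hl : ‖l‖ = Real.exp κ) : ‖m‖ = Real.exp (-κ) := by
  rw [Real.exp_neg]
  exact eq_inv_of_mul_eq_one_right (by rw [← hl, ← norm_mul, hlm, norm_one])

section Recurrence

variable {F : Type*} [NormedAddCommGroup F] [NormedSpace ℂ F] {h : ℝ → F} {R κ : ℝ} {l m : ℂ}

theorem exists_bound_of_multiplicative (hc : Continuous h) (hl : ‖l‖ = Real.exp κ)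
    (hh : ∀ x, R ≤ x → h (x + 1) = l • h x) :
    ∃ C, ∀ x, 0 ≤ x → ‖h x‖ ≤ C * Real.exp (κ * x) := by
  obtain ⟨C, hC⟩ := (isCompact_Icc (a := (0 : ℝ)) (b := |R| + 1)).exists_bound_of_continuousOn
    (f := fun x => Real.exp (-(κ * x)) • h x) (by fun_prop)
  have hstart : ∀ x ∈ Set.Icc 0 (|R| + 1), ‖h x‖ ≤ C * Real.exp (κ * x) := fun x hx => by
    have := hC x hx
    rw [norm_smul, Real.norm_eq_abs, Real.abs_exp, Real.exp_neg,
      inv_mul_le_iff₀ (Real.exp_pos _)] at this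
    linarith
  have hind : ∀ n : ℕ, ∀ x ∈ Set.Icc 0 (|R| + 1 + n), ‖h x‖ ≤ C * Real.exp (κ * x) := by
    intro n
    induction n with
    | zero => simpa using hstart
    | succ n ih =>
      intro x hx
      rcases le_total x (|R| + 1) with hxR | hxR
      · exact hstart x ⟨hx.1, hxR⟩
      have hRx : R ≤ x - 1 := (le_abs_self R).trans (by linarith)
      have hxn := hx.2
      push_cast at hxn
      calc ‖h x‖ = Real.exp κ * ‖h (x - 1)‖ := by
            rw [← hl, ← norm_smul, ← hh _ hRx, sub_add_cancel]
        _ ≤ Real.exp κ * (C * Real.exp (κ * (x - 1))) := by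
            gcongr
            exact ih _ ⟨by linarith [abs_nonneg R], by linarith⟩
        _ = C * (Real.exp κ * Real.exp (κ * (x - 1))) := by ring
        _ = C * Real.exp (κ * x) := by rw [← Real.exp_add]; ring_nf
  refine ⟨C, fun x hx => ?_⟩
  obtain ⟨n, hn⟩ := exists_nat_ge x
  exact hind n x ⟨hx, by linarith [abs_nonneg R]⟩

theorem multiplicative_of_recurrence (hlm : l * m = 1)
    (hh : ∀ x, R ≤ x → h (x + 2) = (l + m) • h (x + 1) - h x) :
    ∀ x, R ≤ x → h (x + 1 + 1) - m • h (x + 1) = l • (h (x + 1) - m • h x) := fun x hx => by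
  rw [add_assoc, one_add_one_eq_two, hh x hx, smul_sub, smul_smul, hlm]
  module

theorem exists_bound_of_recurrence (hc : Continuous h) (hκ : 0 < κ) (hlm : l * m = 1)
    (hl : ‖l‖ = Real.exp κ) (hh : ∀ x, R ≤ x → h (x + 2) = (l + m) • h (x + 1) - h x) :
    ∃ C, ∀ x, 0 ≤ x → ‖h x‖ ≤ C * Real.exp (κ * x) := by
  have hm := norm_eq_exp_neg_of_mul_eq_one hlm hl
  obtain ⟨C₁, hC₁⟩ := exists_bound_of_multiplicative (h := fun x => h (x + 1) - m • h x)
    (by fun_prop) hl (multiplicative_of_recurrence hlm hh)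
  obtain ⟨C₂, hC₂⟩ := exists_bound_of_multiplicative (h := fun x => h (x + 1) - l • h x)
    (by fun_prop) hm (multiplicative_of_recurrence (by rwa [mul_comm]) (by rwa [add_comm]))
  have hne : 0 < ‖l - m‖ := by
    refine norm_pos_iff.2 (sub_ne_zero.2 fun h => ?_)
    rw [h, hm, Real.exp_eq_exp] at hl
    linarith
  have hC₂nonneg : 0 ≤ C₂ := by simpa using (norm_nonneg _).trans (hC₂ 0 le_rfl)
  refine ⟨(C₁ + C₂) / ‖l - m‖, fun x hx => ?_⟩
  rw [div_mul_eq_mul_div, le_div_iff₀ hne, mul_comm, ← norm_smul]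
  calc ‖(l - m) • h x‖ = ‖(h (x + 1) - m • h x) - (h (x + 1) - l • h x)‖ := by congr 1; module
    _ ≤ C₁ * Real.exp (κ * x) + C₂ * Real.exp (-κ * x) :=
        (norm_sub_le _ _).trans (add_le_add (hC₁ x hx) (hC₂ x hx))
    _ ≤ C₁ * Real.exp (κ * x) + C₂ * Real.exp (κ * x) := by gcongr; linarith
    _ = (C₁ + C₂) * Real.exp (κ * x) := by ring

theorem tendsto_integral_add_natCast_zero {p : ℝ → ℝ} (hp : Integrable p) (x : ℝ) :
    Filter.Tendsto (fun n : ℕ => ∫ t in (x + n)..(x + n + 1), p t) Filter.atTop (nhds 0) := by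
  have hstart : Filter.Tendsto (fun n : ℕ => x + (n : ℝ)) Filter.atTop Filter.atTop :=
    Filter.tendsto_atTop_add_const_left _ _ tendsto_natCast_atTop_atTop
  have hend := Filter.tendsto_atTop_add_const_right _ (1 : ℝ) hstart
  have hdiff := (intervalIntegral_tendsto_integral_Ioi x hp.integrableOn hend).sub
    (intervalIntegral_tendsto_integral_Ioi x hp.integrableOn hstart)
  rw [sub_self] at hdiff
  exact hdiff.congr fun n => intervalIntegral.integral_interval_sub_left
    hp.intervalIntegrable hp.intervalIntegrable

theorem eq_zero_of_memLp_of_multiplicative (hc : Continuous h)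
    (hL : MemLp h 2 (volume : Measure ℝ)) (hl : 1 ≤ ‖l‖)
    (hh : ∀ x, R ≤ x → h (x + 1) = l • h x) {x : ℝ} (hx : R ≤ x) : h x = 0 := by
  have hsq_integrable : Integrable (fun x => ‖h x‖ ^ 2) volume := by
    simpa using hL.integrable_norm_pow two_ne_zero
  have hmono : Monotone fun n : ℕ => ∫ t in (x + n)..(x + n + 1), ‖h t‖ ^ 2 := by
    refine monotone_nat_of_le_succ fun n => ?_
    rw [Nat.cast_succ, ← add_assoc,
      ← intervalIntegral.integral_comp_add_right (fun t => ‖h t‖ ^ 2) 1]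
    refine intervalIntegral.integral_mono_on (by linarith) hsq_integrable.intervalIntegrable
      (Continuous.intervalIntegrable (by fun_prop) _ _) fun t ht => ?_
    rw [hh t (by linarith [ht.1, n.cast_nonneg (α := ℝ)]), norm_smul]
    gcongr
    exact le_mul_of_one_le_left (norm_nonneg _) hl
  have hle := hmono.ge_of_tendsto (tendsto_integral_add_natCast_zero hsq_integrable x) 0
  by_contra hne
  have hpos : 0 < ∫ t in x..(x + 1), ‖h t‖ ^ 2 :=
    intervalIntegral.integral_pos (by linarith) (by fun_prop) (fun t _ => by positivity)
      ⟨x, ⟨le_rfl, by linarith⟩, by positivity⟩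
  simp only [Nat.cast_zero, add_zero] at hle
  linarith

theorem eq_smul_of_memLp_of_recurrence (hc : Continuous h)
    (hL : MemLp h 2 (volume : Measure ℝ)) (hlm : l * m = 1) (hl : 1 ≤ ‖l‖)
    (hh : ∀ x, R ≤ x → h (x + 2) = (l + m) • h (x + 1) - h x) {x : ℝ} (hx : R ≤ x) :
    h (x + 1) = m • h x := by
  have hshift : MemLp (fun x => h (x + 1)) 2 (volume : Measure ℝ) :=
    hL.comp_measurePreserving (measurePreserving_add_right volume 1)
  exact sub_eq_zero.1 (eq_zero_of_memLp_of_multiplicative (h := fun x => h (x + 1) - m • h x)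
    (by fun_prop) (hshift.sub (hL.const_smul m)) hl (multiplicative_of_recurrence hlm hh) hx)

theorem exists_cauchyData_decay_of_memLp (hf : Differentiable ℝ f) (hf' : Continuous (deriv f))
    (hL : MemLp f 2 (volume : Measure ℝ)) (hlm : l * m = 1) (hκ : 0 < κ)
    (hl : ‖l‖ = Real.exp κ) (hh : ∀ x, R ≤ x → f (x + 2) = (l + m) • f (x + 1) - f x) :
    ∃ C, ∀ x, 0 ≤ x → ‖cauchyData f x‖ ≤ C * Real.exp (-κ * x) := by
  have hone : 1 ≤ ‖l‖ := hl ▸ Real.one_le_exp hκ.le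
  refine exists_bound_of_multiplicative (R := R + 1) (hf.continuous.prodMk hf')
    (norm_eq_exp_neg_of_mul_eq_one hlm hl) fun x hx => ?_
  have hshift : (fun t => f (t + 1)) =ᶠ[nhds x] fun t => m * f t := by
    filter_upwards [lt_mem_nhds (show R < x by linarith)] with t ht using
      eq_smul_of_memLp_of_recurrence hf.continuous hL hlm hone hh ht.le
  rw [← cauchyData_comp_add_const, cauchyData_congr hshift, cauchyData,
    deriv_const_mul _ (hf x), cauchyData, Prod.smul_mk, smul_eq_mul, smul_eq_mul]

end Recurrence

theorem exists_mul_eq_one_add_eq (τ : ℂ) : ∃ l m : ℂ, l * m = 1 ∧ l + m = τ ∧ 1 ≤ ‖l‖ := by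
  obtain ⟨s, hs⟩ := IsAlgClosed.exists_pow_nat_eq (τ ^ 2 / 4 - 1) (n := 2) two_pos
  have hprod : (τ / 2 + s) * (τ / 2 - s) = 1 := by linear_combination (-1) * hs
  rcases le_total 1 ‖τ / 2 + s‖ with h | h
  · exact ⟨τ / 2 + s, τ / 2 - s, hprod, by ring, h⟩
  · refine ⟨τ / 2 - s, τ / 2 + s, by rw [mul_comm, hprod], by ring, ?_⟩
    have := congrArg norm hprod
    rw [norm_mul, norm_one] at this
    nlinarith [norm_nonneg (τ / 2 - s)]

theorem continuous_of_periodic_of_eq {F : Type*} [TopologicalSpace F] {p q : ℝ → F} {ρ : ℝ}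
    (hp : Continuous p) (hpq : ∀ x, ρ < x → p x = q x) (hq : Function.Periodic q 1) :
    Continuous q := by
  refine continuous_iff_continuousAt.2 fun x => ?_
  obtain ⟨n, hn⟩ := exists_nat_gt (ρ - x + 1)
  have hc : ContinuousAt (fun t => p (t + n)) x := by fun_prop
  refine hc.congr ?_
  filter_upwards [lt_mem_nhds (show x - 1 < x by linarith)] with t ht
  rw [hpq _ (by linarith), ← mul_one (n : ℝ), hq.nat_mul n]

theorem exists_forall_le_mul_exp_abs {p : ℝ → ℝ} {c C₁ C₂ : ℝ}
    (hright : ∀ x, 0 ≤ x → p x ≤ C₁ * Real.exp (c * x))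
    (hleft : ∀ x, 0 ≤ x → p (-x) ≤ C₂ * Real.exp (c * x)) :
    ∃ C, ∀ x, p x ≤ C * Real.exp (c * |x|) := by
  refine ⟨max C₁ C₂, fun x => ?_⟩
  rcases le_total 0 x with hx | hx
  · rw [abs_of_nonneg hx]
    exact (hright x hx).trans (by gcongr; exact le_max_left _ _)
  · rw [abs_of_nonpos hx]
    simpa using (hleft (-x) (by linarith)).trans
      (mul_le_mul_of_nonneg_right (le_max_right C₁ C₂) (Real.exp_pos _).le)

section BoundState

variable {ρ E κ : ℝ} {l m : ℂ} {Φ : ℝ → ℂ}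

namespace IsSchrodingerSolution

theorem recurrence_right (hVW : ∀ x, ρ < |x| → V x = W x) (hW : Continuous W)
    (hper : Function.Periodic W 1) (hf : IsSchrodingerSolution V z f) {x : ℝ}
    (hx : |ρ| + 1 ≤ x) :
    cauchyData f (x + 2) = discriminant W z • cauchyData f (x + 1) - cauchyData f x :=
  hf.cauchyData_add_two_of_eqOn hW hper fun t ht =>
    hVW t (by linarith [le_abs_self t, le_abs_self ρ, ht.1])

theorem recurrence_left (hVW : ∀ x, ρ < |x| → V x = W x) (hW : Continuous W)
    (hper : Function.Periodic W 1) (hf : IsSchrodingerSolution V z f) {x : ℝ}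
    (hx : |ρ| + 1 ≤ x) :
    cauchyData f (-(x + 2)) = discriminant W z • cauchyData f (-(x + 1)) - cauchyData f (-x) := by
  have h := hf.cauchyData_add_two_of_eqOn hW hper (x := -(x + 2)) fun t ht =>
    hVW t (by linarith [neg_le_abs t, le_abs_self ρ, ht.2])
  rw [show -(x + 2) + 2 = -x by ring, show -(x + 2) + 1 = -(x + 1) by ring] at h
  rw [h]
  abel

theorem exists_norm_cauchyData_le (hVW : ∀ x, ρ < |x| → V x = W x) (hW : Continuous W)
    (hper : Function.Periodic W 1) (hf : IsSchrodingerSolution V z f) (hκ : 0 < κ)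
    (hlm : l * m = 1) (hτ : l + m = discriminant W z) (hl : ‖l‖ = Real.exp κ) :
    ∃ C, ∀ x, ‖cauchyData f x‖ ≤ C * Real.exp (κ * |x|) := by
  have hc := hf.continuous_cauchyData
  obtain ⟨C₁, hC₁⟩ := exists_bound_of_recurrence hc hκ hlm hl fun x hx => by
    rw [hτ]
    exact hf.recurrence_right hVW hW hper hx
  obtain ⟨C₂, hC₂⟩ := exists_bound_of_recurrence (h := fun x => cauchyData f (-x)) (by fun_prop)
    hκ hlm hl fun x hx => by
      rw [hτ]
      exact hf.recurrence_left hVW hW hper hx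
  exact exists_forall_le_mul_exp_abs hC₁ hC₂

end IsSchrodingerSolution

namespace IsBoundState

theorem one_lt_norm_multiplier (hV : Continuous V) (hVW : ∀ x, ρ < |x| → V x = W x)
    (hW : Continuous W) (hper : Function.Periodic W 1) (hΦ : IsBoundState V E Φ)
    (hlm : l * m = 1) (hτ : l + m = discriminant W E) (hl : 1 ≤ ‖l‖) : 1 < ‖l‖ := by
  obtain ⟨hne, hL, hsol⟩ := hΦ
  refine lt_of_le_of_ne hl fun heq => hne ?_
  have hm : 1 ≤ ‖m‖ := by
    rw [← one_mul ‖m‖, heq, ← norm_mul, hlm, norm_one, ← heq]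
  have hmult : ∀ x, |ρ| + 1 ≤ x → Φ (x + 1) = m * Φ x := fun x =>
    eq_smul_of_memLp_of_recurrence hsol.continuous hL hlm hl fun x hx => by
      rw [hτ]
      exact congrArg Prod.fst (hsol.recurrence_right hVW hW hper hx)
  refine hsol.eq_zero_of_eventually_eq_zero hV (x₀ := |ρ| + 2) ?_
  filter_upwards [lt_mem_nhds (show |ρ| + 1 < |ρ| + 2 by linarith)] with x hx using
    eq_zero_of_memLp_of_multiplicative hsol.continuous hL hm hmult hx.le

theorem exists_norm_cauchyData_le (hVW : ∀ x, ρ < |x| → V x = W x) (hW : Continuous W)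
    (hper : Function.Periodic W 1) (hΦ : IsBoundState V E Φ) (hκ : 0 < κ)
    (hlm : l * m = 1) (hτ : l + m = discriminant W E) (hl : ‖l‖ = Real.exp κ) :
    ∃ C, ∀ x, ‖cauchyData Φ x‖ ≤ C * Real.exp (-κ * |x|) := by
  obtain ⟨-, hL, hsol⟩ := hΦ
  obtain ⟨C₁, hC₁⟩ := exists_cauchyData_decay_of_memLp hsol.1 hsol.continuous_deriv hL hlm hκ hl
    fun x hx => by
      rw [hτ]
      exact congrArg Prod.fst (hsol.recurrence_right hVW hW hper hx)
  obtain ⟨C₂, hC₂⟩ := exists_cauchyData_decay_of_memLp hsol.comp_neg.1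
    hsol.comp_neg.continuous_deriv
    (hL.comp_measurePreserving (Measure.measurePreserving_neg volume)) hlm hκ hl
    fun x hx => by
      rw [hτ]
      exact congrArg Prod.fst (hsol.recurrence_left hVW hW hper hx)
  simp only [norm_cauchyData_comp_neg] at hC₂
  exact exists_forall_le_mul_exp_abs hC₁ hC₂

theorem exists_isFloquetExponent (hV : Continuous V) (hVW : ∀ x, ρ < |x| → V x = W x)
    (hper : Function.Periodic W 1) (hΦ : IsBoundState V E Φ) :
    ∃ κ, IsFloquetExponent W E κ ∧
      (∃ C, ∀ x, ‖cauchyData Φ x‖ ≤ C * Real.exp (-κ * |x|)) ∧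
      ∀ f, IsSchrodingerSolution V E f → ∃ C, ∀ x, ‖cauchyData f x‖ ≤ C * Real.exp (κ * |x|) := by
  have hW : Continuous W :=
    continuous_of_periodic_of_eq hV (fun x hx => hVW x (hx.trans_le (le_abs_self x))) hper
  obtain ⟨l, m, hlm, hτ, hl⟩ := exists_mul_eq_one_add_eq (discriminant W E)
  have hl := hΦ.one_lt_norm_multiplier hV hVW hW hper hlm hτ hl
  have hκ : 0 < Real.log ‖l‖ := Real.log_pos hl
  have hexp : ‖l‖ = Real.exp (Real.log ‖l‖) := (Real.exp_log (by linarith)).symm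
  have hne : l ≠ m := by
    rintro rfl
    have := congrArg norm hlm
    rw [norm_mul, norm_one] at this
    nlinarith
  obtain ⟨y, hy⟩ := exists_floquetSolution hW hper hlm hτ hne
  exact ⟨Real.log ‖l‖, ⟨hκ, l, y, hexp, hy⟩,
    hΦ.exists_norm_cauchyData_le hVW hW hper hκ hlm hτ hexp,
    fun f hf => hf.exists_norm_cauchyData_le hVW hW hper hκ hlm hτ hexp⟩

end IsBoundState

end BoundState

end Floquet

/-! ### The outgoing defect -/

theorem csqrt_sq (z : ℂ) : csqrt z ^ 2 = z := by
  rw [csqrt, ← Complex.cpow_nat_mul]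
  norm_num

theorem csqrt_ofReal {x : ℝ} (hx : 0 ≤ x) : csqrt x = (Real.sqrt x : ℂ) := by
  rw [csqrt, Real.sqrt_eq_rpow, Complex.ofReal_cpow hx]
  norm_num

theorem csqrt_re_nonneg (z : ℂ) : 0 ≤ (csqrt z).re := by
  rcases eq_or_ne z 0 with rfl | hz
  · simp [csqrt]
  have harg : (Complex.log z * (1 / 2)).im = z.arg / 2 := by
    rw [show (1 / 2 : ℂ) = ((1 / 2 : ℝ) : ℂ) by push_cast; rfl, Complex.im_mul_ofReal,
      Complex.log_im]
    ring
  rw [csqrt, Complex.cpow_def_of_ne_zero hz, Complex.exp_re, harg]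
  refine mul_nonneg (Real.exp_pos _).le (Real.cos_nonneg_of_mem_Icc ⟨?_, ?_⟩) <;>
    linarith [Complex.neg_pi_lt_arg z, Complex.arg_le_pi z]

theorem sqrt_le_csqrt_re {z : ℂ} {c : ℝ} (hz : c ≤ z.re) : Real.sqrt c ≤ (csqrt z).re := by
  have hre : (csqrt z).re ^ 2 - (csqrt z).im ^ 2 = z.re := by
    simpa [pow_two] using congrArg Complex.re (csqrt_sq z)
  exact Real.sqrt_le_iff.2 ⟨csqrt_re_nonneg z, by linarith [sq_nonneg (csqrt z).im]⟩

theorem norm_csqrt_sub_le {z w : ℂ} {c : ℝ} (hc : 0 < c) (hz : c ≤ z.re) :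
    ‖csqrt z - csqrt w‖ ≤ ‖z - w‖ / Real.sqrt c := by
  have hsum : Real.sqrt c ≤ ‖csqrt z + csqrt w‖ :=
    calc Real.sqrt c ≤ (csqrt z).re + (csqrt w).re :=
          (sqrt_le_csqrt_re hz).trans (le_add_of_nonneg_right (csqrt_re_nonneg w))
      _ ≤ ‖csqrt z + csqrt w‖ := Complex.re_le_norm (csqrt z + csqrt w)
  rw [le_div_iff₀ (Real.sqrt_pos.2 hc)]
  calc ‖csqrt z - csqrt w‖ * Real.sqrt c
      ≤ ‖csqrt z - csqrt w‖ * ‖csqrt z + csqrt w‖ := by gcongr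
    _ = ‖csqrt z ^ 2 - csqrt w ^ 2‖ := by rw [← norm_mul]; ring_nf
    _ = ‖z - w‖ := by rw [csqrt_sq, csqrt_sq]

theorem norm_csqrt_sub_mul_add_csqrt_sub_mul_le {z₀ z₁ z₂ : ℂ} {c : ℝ} (hc : 0 < c)
    (hz₁ : c ≤ z₁.re) (p q : ℂ) :
    ‖(csqrt z₁ - csqrt z₀) * p + (csqrt z₁ - csqrt z₂) * q‖
      ≤ (‖z₁ - z₀‖ * ‖p‖ + ‖z₁ - z₂‖ * ‖q‖) / Real.sqrt c :=
  calc _ ≤ ‖csqrt z₁ - csqrt z₀‖ * ‖p‖ + ‖csqrt z₁ - csqrt z₂‖ * ‖q‖ := by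
        rw [← norm_mul, ← norm_mul]
        exact norm_add_le _ _
    _ ≤ ‖z₁ - z₀‖ / Real.sqrt c * ‖p‖ + ‖z₁ - z₂‖ / Real.sqrt c * ‖q‖ := by
        gcongr <;> exact norm_csqrt_sub_le hc hz₁
    _ = _ := by ring

/-- `f'(x) - i √z f(x)` as a linear functional of the Cauchy data `p` of `f` at `x`. -/
noncomputable def outgoingDefect (z : ℂ) (p : ℂ × ℂ) : ℂ := p.2 - Complex.I * csqrt z * p.1

theorem outPlus_eq_outgoingDefect (z : ℂ) (f : ℝ → ℂ) (x : ℝ) :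
    outPlus z f x = outgoingDefect z (cauchyData f x) :=
  rfl

theorem outMinus_eq_neg_outPlus_comp_neg (z : ℂ) (f : ℝ → ℂ) (x : ℝ) :
    outMinus z f x = -outPlus z (fun t => f (-t)) x := by
  simp only [outMinus, outPlus, deriv_comp_neg]
  ring

theorem norm_outgoingDefect_le {E : ℝ} (hE : 0 ≤ E) (p : ℂ × ℂ) :
    ‖outgoingDefect E p‖ ≤ (1 + Real.sqrt E) * ‖p‖ := by
  have hmul : ‖Complex.I * csqrt E * p.1‖ = Real.sqrt E * ‖p.1‖ := by
    rw [csqrt_ofReal hE, norm_mul, norm_mul, Complex.norm_I, one_mul, Complex.norm_real,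
      Real.norm_of_nonneg (Real.sqrt_nonneg E)]
  calc ‖outgoingDefect E p‖ ≤ ‖p.2‖ + ‖Complex.I * csqrt E * p.1‖ := norm_sub_le _ _
    _ ≤ ‖p‖ + Real.sqrt E * ‖p‖ := by
        rw [hmul]
        gcongr
        exacts [norm_snd_le p, norm_fst_le p]
    _ = (1 + Real.sqrt E) * ‖p‖ := by ring

theorem norm_le_norm_outgoingDefect {E : ℝ} (hE : 0 < E) {p : ℂ × ℂ} (hp₁ : p.1.im = 0)
    (hp₂ : p.2.im = 0) : ‖p‖ ≤ (1 + 1 / Real.sqrt E) * ‖outgoingDefect E p‖ := by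
  have hs : 0 < Real.sqrt E := Real.sqrt_pos.2 hE
  have hre : (outgoingDefect E p).re = p.2.re := by
    simp [outgoingDefect, csqrt_ofReal hE.le, hp₁]
  have him : (outgoingDefect E p).im = -(Real.sqrt E * p.1.re) := by
    simp [outgoingDefect, csqrt_ofReal hE.le, hp₁, hp₂]
  have hfst : ‖p.1‖ ≤ 1 / Real.sqrt E * ‖outgoingDefect E p‖ := by
    have := Complex.abs_im_le_norm (outgoingDefect E p)
    rw [him, abs_neg, abs_mul, abs_of_pos hs, Complex.abs_re_eq_norm.2 hp₁] at this
    rwa [one_div, le_inv_mul_iff₀ hs]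
  have hsnd : ‖p.2‖ ≤ ‖outgoingDefect E p‖ := by
    rw [← Complex.abs_re_eq_norm.2 hp₂, ← hre]
    exact Complex.abs_re_le_norm _
  have : 0 ≤ 1 / Real.sqrt E * ‖outgoingDefect E p‖ := by positivity
  exact max_le (by linarith [norm_nonneg (outgoingDefect E p)]) (by linarith)

theorem outPlus_sub_sub_mul_eq (z₀ z₁ z₂ c : ℂ) (f₁ f₂ v : ℝ → ℂ) (x : ℝ) :
    outPlus z₁ f₁ x - outPlus z₂ f₂ x - outPlus z₀ v x * c
      = outgoingDefect z₀ (cauchyData f₁ x - cauchyData f₂ x - c • cauchyData v x)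
        - Complex.I * ((csqrt z₁ - csqrt z₀) * (f₁ x - f₂ x) + (csqrt z₁ - csqrt z₂) * f₂ x) := by
  simp only [outPlus, outgoingDefect, cauchyData, Prod.mk_sub_mk, Prod.smul_mk, smul_eq_mul]
  ring

/-! ### Dichotomy pairs -/

/-- A fundamental system with unit Wronskian at energy `E` consisting of a solution `u` decaying
like `exp (-κ |x|)` and a solution `v` growing at most like `exp (κ |x|)`. -/
structure IsDichotomyPair (V : ℝ → ℝ) (E κ B : ℝ) (u v : ℝ → ℂ) : Prop where
  pos : 0 < κ
  isSolution_left : IsSchrodingerSolution V E u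
  isSolution_right : IsSchrodingerSolution V E v
  wronskian_zero : wronskian u v 0 = 1
  norm_left_le : ∀ x, ‖cauchyData u x‖ ≤ B * Real.exp (-κ * |x|)
  norm_right_le : ∀ x, ‖cauchyData v x‖ ≤ B * Real.exp (κ * |x|)

/-- `f` is the solution at energy `z` with the Cauchy data of `(1 + a δ) u + δ v` at `0`, so that
`f = u` when `z = E` and `δ = 0`. -/
structure IsPerturbation (V : ℝ → ℝ) (u v : ℝ → ℂ) (a z δ : ℂ) (f : ℝ → ℂ) : Prop where
  isSolution : IsSchrodingerSolution V z f
  cauchyData_zero : cauchyData f 0 = (1 + a * δ) • cauchyData u 0 + δ • cauchyData v 0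

theorem IsPerturbation.comp_neg {V : ℝ → ℝ} {u v f : ℝ → ℂ} {a z δ : ℂ}
    (hf : IsPerturbation V u v a z δ f) :
    IsPerturbation (fun x => V (-x)) (fun x => u (-x)) (fun x => -v (-x)) (-a) z (-δ)
      (fun x => f (-x)) where
  isSolution := hf.isSolution.comp_neg
  cauchyData_zero := by
    have h := hf.cauchyData_zero
    simp only [cauchyData, deriv.fun_neg, deriv_comp_neg, neg_zero, Prod.ext_iff, Prod.fst_add,
      Prod.snd_add, Prod.smul_fst, Prod.smul_snd, smul_eq_mul] at h ⊢
    exact ⟨by linear_combination h.1, by linear_combination -h.2⟩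

theorem integral_exp_mul_sub_mul_le {κ G₁ G₂ : ℝ} (hκ : 0 < κ) (hG₁ : 0 ≤ G₁) (x : ℝ) :
    ∫ t in (0 : ℝ)..x, Real.exp (κ * (x - t)) * (G₁ * Real.exp (-κ * t) + G₂ * Real.exp (κ * t))
      ≤ Real.exp (κ * x) * (G₁ / (2 * κ) + G₂ * x) := by
  have hsplit (t : ℝ) :
      Real.exp (κ * (x - t)) * (G₁ * Real.exp (-κ * t) + G₂ * Real.exp (κ * t))
        = Real.exp (κ * x) * (G₁ * Real.exp (-(2 * κ) * t) + G₂) := by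
    rw [show -(2 * κ) * t = -κ * t + -κ * t by ring, show κ * (x - t) = κ * x + -κ * t by ring,
      Real.exp_add, Real.exp_add, show κ * t = -(-κ * t) by ring, Real.exp_neg (-κ * t)]
    field_simp
  have hexp : ∫ t in (0 : ℝ)..x, Real.exp (-(2 * κ) * t)
      = 1 / (2 * κ) - Real.exp (-(2 * κ) * x) / (2 * κ) := by
    rw [intervalIntegral.integral_comp_mul_left _ (by linarith : -(2 * κ) ≠ 0), integral_exp,
      mul_zero, Real.exp_zero, smul_eq_mul]
    field_simp
    ring
  simp only [hsplit]
  rw [intervalIntegral.integral_const_mul, intervalIntegral.integral_add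
    (Continuous.intervalIntegrable (by fun_prop) _ _) intervalIntegrable_const,
    intervalIntegral.integral_const_mul, intervalIntegral.integral_const, hexp, smul_eq_mul]
  refine mul_le_mul_of_nonneg_left ?_ (Real.exp_pos _).le
  have : 0 ≤ G₁ * (Real.exp (-(2 * κ) * x) / (2 * κ)) := by positivity
  calc G₁ * (1 / (2 * κ) - Real.exp (-(2 * κ) * x) / (2 * κ)) + (x - 0) * G₂
      = G₁ / (2 * κ) + G₂ * x - G₁ * (Real.exp (-(2 * κ) * x) / (2 * κ)) := by ring
    _ ≤ G₁ / (2 * κ) + G₂ * x := by linarith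

/-- A continuity argument in Gronwall style: a bound which improves itself by half its own size
holds with the improved constant doubled. -/
theorem le_two_mul_exp_of_self_improving {φ : ℝ → ℝ} {κ K M : ℝ} (hM : 0 ≤ M)
    (hφ : Continuous φ) (hφ0 : ∀ x, 0 ≤ φ x)
    (himp : ∀ S, 0 ≤ S → (∀ t ∈ Set.Icc 0 M, φ t ≤ S * Real.exp (κ * t)) →
      ∀ t ∈ Set.Icc 0 M, φ t ≤ (K + S / 2) * Real.exp (κ * t)) :
    ∀ t ∈ Set.Icc 0 M, φ t ≤ 2 * K * Real.exp (κ * t) := by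
  obtain ⟨x₀, hx₀, hmax⟩ := (isCompact_Icc (a := (0 : ℝ)) (b := M)).exists_isMaxOn
    ⟨0, le_rfl, hM⟩ (f := fun t => φ t / Real.exp (κ * t))
    (Continuous.continuousOn (by fun_prop (disch := intro; positivity)))
  set S := φ x₀ / Real.exp (κ * x₀)
  have hS : ∀ t ∈ Set.Icc 0 M, φ t ≤ S * Real.exp (κ * t) := fun t ht =>
    (div_le_iff₀ (Real.exp_pos _)).1 (hmax ht)
  have hS_le : S ≤ K + S / 2 :=
    (div_le_iff₀ (Real.exp_pos _)).2 (himp S (div_nonneg (hφ0 x₀) (Real.exp_pos _).le) hS x₀ hx₀)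
  intro t ht
  refine (hS t ht).trans ?_
  gcongr
  linarith

namespace IsDichotomyPair

variable {V : ℝ → ℝ} {E κ B : ℝ} {u v : ℝ → ℂ}

theorem bound_nonneg (h : IsDichotomyPair V E κ B u v) : 0 ≤ B := by
  simpa using (norm_nonneg _).trans (h.norm_left_le 0)

theorem wronskian_eq_one (h : IsDichotomyPair V E κ B u v) (x : ℝ) : wronskian u v x = 1 :=
  (h.isSolution_left.wronskian_eq h.isSolution_right 0 x).trans h.wronskian_zero

theorem norm_left_le_of_nonneg (h : IsDichotomyPair V E κ B u v) {x : ℝ} (hx : 0 ≤ x) :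
    ‖cauchyData u x‖ ≤ B * Real.exp (-κ * x) := by
  simpa only [abs_of_nonneg hx] using h.norm_left_le x

theorem norm_right_le_of_nonneg (h : IsDichotomyPair V E κ B u v) {x : ℝ} (hx : 0 ≤ x) :
    ‖cauchyData v x‖ ≤ B * Real.exp (κ * x) := by
  simpa only [abs_of_nonneg hx] using h.norm_right_le x

theorem isPerturbation_left (h : IsDichotomyPair V E κ B u v) (a : ℂ) :
    IsPerturbation V u v a E 0 u :=
  ⟨h.isSolution_left, by simp⟩

theorem comp_neg (h : IsDichotomyPair V E κ B u v) :
    IsDichotomyPair (fun x => V (-x)) E κ B (fun x => u (-x)) (fun x => -v (-x)) where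
  pos := h.pos
  isSolution_left := h.isSolution_left.comp_neg
  isSolution_right := by
    simpa using h.isSolution_right.comp_neg.linearCombination (.zero _ _) (-1) 0
  wronskian_zero := by
    simpa [wronskian, deriv_comp_neg, mul_comm, add_comm, sub_eq_add_neg] using h.wronskian_zero
  norm_left_le x := by simpa only [norm_cauchyData_comp_neg, abs_neg] using h.norm_left_le (-x)
  norm_right_le x := by
    have hneg : ‖cauchyData (fun t => -v (-t)) x‖ = ‖cauchyData v (-x)‖ := by
      simp [cauchyData, deriv_comp_neg]
    simpa only [hneg, abs_neg] using h.norm_right_le (-x)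

theorem variation_of_parameters (h : IsDichotomyPair V E κ B u v) {g g' k : ℝ → ℂ} {p q : ℂ}
    (hg : ∀ x, HasDerivAt g (g' x) x)
    (hg' : ∀ x, HasDerivAt g' (((V x : ℂ) - E) * g x - k x) x) (hk : Continuous k)
    (h0 : (g 0, g' 0) = p • cauchyData u 0 + q • cauchyData v 0) (x : ℝ) :
    (g x, g' x) = p • cauchyData u x + q • cauchyData v x
      - ∫ t in (0 : ℝ)..x, k t • (u t • cauchyData v x - v t • cauchyData u x) := by
  have := h.isSolution_left.continuous
  have := h.isSolution_right.continuous
  have hgv (t : ℝ) : HasDerivAt (wronskian g v) (k t * v t) t := by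
    rw [show wronskian g v = fun t => g t * deriv v t - g' t * v t from
      funext fun t => by rw [wronskian, (hg t).deriv]]
    exact (((hg t).mul (h.isSolution_right.2 t)).sub
      ((hg' t).mul (h.isSolution_right.hasDerivAt t))).congr_deriv (by ring)
  have hug (t : ℝ) : HasDerivAt (wronskian u g) (-(k t * u t)) t := by
    rw [show wronskian u g = fun t => u t * g' t - deriv u t * g t from
      funext fun t => by rw [wronskian, (hg t).deriv]]
    exact (((h.isSolution_left.hasDerivAt t).mul (hg' t)).sub
      ((h.isSolution_left.2 t).mul (hg t))).congr_deriv (by ring)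
  have hw := h.wronskian_zero
  simp only [Prod.ext_iff, cauchyData, Prod.fst_add, Prod.snd_add, Prod.smul_fst, Prod.smul_snd,
    smul_eq_mul] at h0
  simp only [wronskian] at hw
  have hgv0 : wronskian g v 0 = p := by
    rw [wronskian, (hg 0).deriv, h0.1, h0.2]
    linear_combination p * hw
  have hug0 : wronskian u g 0 = q := by
    rw [wronskian, (hg 0).deriv, h0.1, h0.2]
    linear_combination q * hw
  have hftc := intervalIntegral.integral_eq_sub_of_hasDerivAt (a := 0) (b := x)
    (fun t _ => ((hgv t).smul_const (cauchyData u x)).add ((hug t).smul_const (cauchyData v x)))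
    (Continuous.intervalIntegrable (by fun_prop) _ _)
  simp only [Pi.add_apply, hgv0, hug0, ← cauchyData_eq_wronskian_smul (h.wronskian_eq_one x)]
    at hftc
  rw [← (hg x).deriv, ← cauchyData, sub_eq_add_neg, ← sub_eq_iff_eq_add', ← hftc,
    ← intervalIntegral.integral_neg]
  exact intervalIntegral.integral_congr fun t _ => by
    simp only [smul_sub, smul_smul, neg_smul]
    abel

theorem norm_greenKernel_le (h : IsDichotomyPair V E κ B u v) {t x : ℝ} (ht : 0 ≤ t)
    (htx : t ≤ x) :
    ‖u t • cauchyData v x - v t • cauchyData u x‖ ≤ 2 * B ^ 2 * Real.exp (κ * (x - t)) := by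
  have hB := h.bound_nonneg
  have hut := (norm_apply_le_norm_cauchyData u t).trans (h.norm_left_le_of_nonneg ht)
  have hvt := (norm_apply_le_norm_cauchyData v t).trans (h.norm_right_le_of_nonneg ht)
  have hux := h.norm_left_le_of_nonneg (ht.trans htx)
  have hvx := h.norm_right_le_of_nonneg (ht.trans htx)
  have hsymm : Real.exp (-κ * x + κ * t) ≤ Real.exp (κ * (x - t)) :=
    Real.exp_le_exp.2 (by nlinarith [h.pos])
  calc ‖u t • cauchyData v x - v t • cauchyData u x‖
      ≤ ‖u t‖ * ‖cauchyData v x‖ + ‖v t‖ * ‖cauchyData u x‖ := by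
        simpa only [norm_smul] using norm_sub_le (u t • cauchyData v x) (v t • cauchyData u x)
    _ ≤ B * Real.exp (-κ * t) * (B * Real.exp (κ * x))
          + B * Real.exp (κ * t) * (B * Real.exp (-κ * x)) := by gcongr
    _ = B ^ 2 * (Real.exp (κ * (x - t)) + Real.exp (-κ * x + κ * t)) := by
        rw [show κ * (x - t) = -κ * t + κ * x by ring, Real.exp_add, Real.exp_add]
        ring
    _ ≤ 2 * B ^ 2 * Real.exp (κ * (x - t)) := by nlinarith [sq_nonneg B]

theorem norm_integral_greenKernel_le (h : IsDichotomyPair V E κ B u v) {k : ℝ → ℂ} {x G₁ G₂ : ℝ}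
    (hx : 0 ≤ x) (hG₁ : 0 ≤ G₁)
    (hk : ∀ t ∈ Set.Icc 0 x, ‖k t‖ ≤ G₁ * Real.exp (-κ * t) + G₂ * Real.exp (κ * t)) :
    ‖∫ t in (0 : ℝ)..x, k t • (u t • cauchyData v x - v t • cauchyData u x)‖
      ≤ 2 * B ^ 2 * (G₁ / (2 * κ) + G₂ * x) * Real.exp (κ * x) := by
  have hpointwise (t : ℝ) (ht : t ∈ Set.Icc 0 x) :
      ‖k t • (u t • cauchyData v x - v t • cauchyData u x)‖ ≤ 2 * B ^ 2 *
        (Real.exp (κ * (x - t)) * (G₁ * Real.exp (-κ * t) + G₂ * Real.exp (κ * t))) := by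
    rw [norm_smul, mul_comm, ← mul_assoc]
    exact mul_le_mul (h.norm_greenKernel_le ht.1 ht.2) (hk t ht) (norm_nonneg _) (by positivity)
  calc _ ≤ ∫ t in (0 : ℝ)..x, 2 * B ^ 2 *
        (Real.exp (κ * (x - t)) * (G₁ * Real.exp (-κ * t) + G₂ * Real.exp (κ * t))) :=
        intervalIntegral.norm_integral_le_of_norm_le hx
          (Filter.Eventually.of_forall fun t ht => hpointwise t ⟨ht.1.le, ht.2⟩)
          (Continuous.intervalIntegrable (by fun_prop) _ _)
    _ ≤ 2 * B ^ 2 * (Real.exp (κ * x) * (G₁ / (2 * κ) + G₂ * x)) := by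
        rw [intervalIntegral.integral_const_mul]
        gcongr
        exact integral_exp_mul_sub_mul_le h.pos hG₁ x
    _ = 2 * B ^ 2 * (G₁ / (2 * κ) + G₂ * x) * Real.exp (κ * x) := by ring

theorem cauchyData_sub_eq (h : IsDichotomyPair V E κ B u v) {a z₁ z₂ δ₁ δ₂ : ℂ} {f₁ f₂ : ℝ → ℂ}
    (hf₁ : IsPerturbation V u v a z₁ δ₁ f₁) (hf₂ : IsPerturbation V u v a z₂ δ₂ f₂) (x : ℝ) :
    cauchyData f₁ x - cauchyData f₂ x
      = (a * (δ₁ - δ₂)) • cauchyData u x + (δ₁ - δ₂) • cauchyData v x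
        - ∫ t in (0 : ℝ)..x, ((z₁ - E) * (f₁ t - f₂ t) + (z₁ - z₂) * f₂ t) •
          (u t • cauchyData v x - v t • cauchyData u x) := by
  have := hf₁.isSolution.continuous
  have := hf₂.isSolution.continuous
  refine h.variation_of_parameters (g := fun t => f₁ t - f₂ t)
    (g' := fun t => deriv f₁ t - deriv f₂ t)
    (fun t => (hf₁.isSolution.hasDerivAt t).sub (hf₂.isSolution.hasDerivAt t))
    (fun t => ((hf₁.isSolution.2 t).sub (hf₂.isSolution.2 t)).congr_deriv (by ring))
    (by fun_prop) ?_ x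
  calc cauchyData f₁ 0 - cauchyData f₂ 0
      = (1 + a * δ₁) • cauchyData u 0 + δ₁ • cauchyData v 0
        - ((1 + a * δ₂) • cauchyData u 0 + δ₂ • cauchyData v 0) := by
        rw [hf₁.cauchyData_zero, hf₂.cauchyData_zero]
    _ = (a * (δ₁ - δ₂)) • cauchyData u 0 + (δ₁ - δ₂) • cauchyData v 0 := by module

theorem norm_cauchyData_sub_le_of_norm_sub_le (h : IsDichotomyPair V E κ B u v)
    {a z₁ z₂ δ₁ δ₂ : ℂ} {f₁ f₂ : ℝ → ℂ} (hf₁ : IsPerturbation V u v a z₁ δ₁ f₁)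
    (hf₂ : IsPerturbation V u v a z₂ δ₂ f₂) {C r S Δ x : ℝ} (hC : 0 ≤ C) (hr : 0 ≤ r)
    (hx : 0 ≤ x) (hz₁ : ‖z₁ - E‖ ≤ r) (hδΔ : ‖δ₁ - δ₂‖ ≤ Δ) (hzΔ : ‖z₁ - z₂‖ ≤ Δ)
    (hf₂C : ∀ t ∈ Set.Icc 0 x, ‖f₂ t‖ ≤ C * (Real.exp (-κ * t) + r * Real.exp (κ * t)))
    (hS : ∀ t ∈ Set.Icc 0 x, ‖f₁ t - f₂ t‖ ≤ S * Real.exp (κ * t)) :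
    ‖cauchyData f₁ x - cauchyData f₂ x‖ ≤ (B * (‖a‖ + 1) * Δ
      + 2 * B ^ 2 * (Δ * C / (2 * κ) + (r * S + Δ * C * r) * x)) * Real.exp (κ * x) := by
  have hκ := h.pos
  have hB := h.bound_nonneg
  have : 0 ≤ Δ := (norm_nonneg _).trans hδΔ
  have hexp : Real.exp (-κ * x) ≤ Real.exp (κ * x) := Real.exp_le_exp.2 (by nlinarith)
  have hinit : ‖(a * (δ₁ - δ₂)) • cauchyData u x + (δ₁ - δ₂) • cauchyData v x‖
      ≤ B * (‖a‖ + 1) * Δ * Real.exp (κ * x) :=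
    calc _ ≤ ‖a‖ * ‖δ₁ - δ₂‖ * ‖cauchyData u x‖ + ‖δ₁ - δ₂‖ * ‖cauchyData v x‖ := by
          simpa only [norm_smul, norm_mul] using
            norm_add_le ((a * (δ₁ - δ₂)) • cauchyData u x) ((δ₁ - δ₂) • cauchyData v x)
      _ ≤ ‖a‖ * Δ * (B * Real.exp (κ * x)) + Δ * (B * Real.exp (κ * x)) := by
          gcongr
          · exact (h.norm_left_le_of_nonneg hx).trans (by gcongr)
          · exact h.norm_right_le_of_nonneg hx
      _ = B * (‖a‖ + 1) * Δ * Real.exp (κ * x) := by ring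
  have hintegral := h.norm_integral_greenKernel_le hx (G₁ := Δ * C) (G₂ := r * S + Δ * C * r)
    (k := fun t => (z₁ - E) * (f₁ t - f₂ t) + (z₁ - z₂) * f₂ t) (by positivity) fun t ht =>
      calc _ ≤ ‖z₁ - E‖ * ‖f₁ t - f₂ t‖ + ‖z₁ - z₂‖ * ‖f₂ t‖ := by
            simpa only [norm_mul] using
              norm_add_le ((z₁ - E) * (f₁ t - f₂ t)) ((z₁ - z₂) * f₂ t)
        _ ≤ r * (S * Real.exp (κ * t))
              + Δ * (C * (Real.exp (-κ * t) + r * Real.exp (κ * t))) := by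
            gcongr
            exacts [hS t ht, hf₂C t ht]
        _ = Δ * C * Real.exp (-κ * t) + (r * S + Δ * C * r) * Real.exp (κ * t) := by ring
  rw [h.cauchyData_sub_eq hf₁ hf₂, add_mul]
  exact (norm_sub_le _ _).trans (add_le_add hinit hintegral)

theorem norm_cauchyData_sub_le (h : IsDichotomyPair V E κ B u v) {a z₁ z₂ δ₁ δ₂ : ℂ}
    {f₁ f₂ : ℝ → ℂ} (hf₁ : IsPerturbation V u v a z₁ δ₁ f₁)
    (hf₂ : IsPerturbation V u v a z₂ δ₂ f₂) {C M r : ℝ} (hC : 0 ≤ C) (hM : 0 ≤ M) (hr : 0 ≤ r)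
    (hMr : M * r ≤ 1) (hBMr : 4 * B ^ 2 * (M * r) ≤ 1) (hz₁ : ‖z₁ - E‖ ≤ r)
    (hf₂C : ∀ t ∈ Set.Icc 0 M, ‖f₂ t‖ ≤ C * (Real.exp (-κ * t) + r * Real.exp (κ * t))) :
    ∀ x ∈ Set.Icc 0 M, ‖cauchyData f₁ x - cauchyData f₂ x‖
      ≤ 2 * ((B * (‖a‖ + 1) + 2 * B ^ 2 * C * (1 / (2 * κ) + 1)) * (‖δ₁ - δ₂‖ + ‖z₁ - z₂‖))
        * Real.exp (κ * x) := by
  have := h.pos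
  have := h.bound_nonneg
  set Δ := ‖δ₁ - δ₂‖ + ‖z₁ - z₂‖
  have hδΔ : ‖δ₁ - δ₂‖ ≤ Δ := le_add_of_nonneg_right (norm_nonneg _)
  have hzΔ : ‖z₁ - z₂‖ ≤ Δ := le_add_of_nonneg_left (norm_nonneg _)
  have : 0 ≤ Δ := (norm_nonneg _).trans hδΔ
  refine le_two_mul_exp_of_self_improving hM (hf₁.isSolution.continuous_cauchyData.sub
    hf₂.isSolution.continuous_cauchyData).norm (fun _ => norm_nonneg _) fun S hS0 hS x hx => ?_
  have hsub {t : ℝ} (ht : t ∈ Set.Icc 0 x) : t ∈ Set.Icc 0 M := ⟨ht.1, ht.2.trans hx.2⟩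
  have hapriori := h.norm_cauchyData_sub_le_of_norm_sub_le hf₁ hf₂ hC hr hx.1 hz₁ hδΔ hzΔ
    (fun t ht => hf₂C t (hsub ht))
    fun t ht => (norm_fst_le (cauchyData f₁ t - cauchyData f₂ t)).trans (hS t (hsub ht))
  refine hapriori.trans (mul_le_mul_of_nonneg_right ?_ (Real.exp_pos _).le)
  calc B * (‖a‖ + 1) * Δ + 2 * B ^ 2 * (Δ * C / (2 * κ) + (r * S + Δ * C * r) * x)
      ≤ B * (‖a‖ + 1) * Δ + 2 * B ^ 2 * (Δ * C / (2 * κ) + (r * S + Δ * C * r) * M) := by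
        have := hx.2
        gcongr
    _ = B * (‖a‖ + 1) * Δ + 2 * B ^ 2 * C * (1 / (2 * κ)) * Δ + 2 * B ^ 2 * C * Δ * (M * r)
          + 4 * B ^ 2 * (M * r) * (S / 2) := by ring
    _ ≤ B * (‖a‖ + 1) * Δ + 2 * B ^ 2 * C * (1 / (2 * κ)) * Δ + 2 * B ^ 2 * C * Δ * 1
          + 1 * (S / 2) := by gcongr
    _ = _ := by ring

theorem norm_sub_left_le (h : IsDichotomyPair V E κ B u v) {a z δ : ℂ} {f : ℝ → ℂ}
    (hf : IsPerturbation V u v a z δ f) {M r : ℝ} (hM : 0 ≤ M) (hr : 0 ≤ r) (hMr : M * r ≤ 1)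
    (hBMr : 4 * B ^ 2 * (M * r) ≤ 1) (hz : ‖z - E‖ ≤ r) (hδ : ‖δ‖ ≤ r) :
    ∀ x ∈ Set.Icc 0 M, ‖f x - u x‖
      ≤ 4 * (B * (‖a‖ + 1) + 2 * B ^ 3 * (1 / (2 * κ) + 1)) * r * Real.exp (κ * x) := by
  have := h.pos
  have hB := h.bound_nonneg
  intro x hx
  have hdata := h.norm_cauchyData_sub_le hf (h.isPerturbation_left a) hB hM hr hMr hBMr hz
    (fun t ht => ((norm_apply_le_norm_cauchyData u t).trans (h.norm_left_le_of_nonneg ht.1)).trans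
      (by gcongr; exact le_add_of_nonneg_right (by positivity))) x hx
  calc ‖f x - u x‖ ≤ _ := (norm_fst_le (cauchyData f x - cauchyData u x)).trans hdata
    _ ≤ 2 * ((B * (‖a‖ + 1) + 2 * B ^ 2 * B * (1 / (2 * κ) + 1)) * (r + r))
          * Real.exp (κ * x) := by gcongr; rwa [sub_zero]
    _ = _ := by ring

theorem norm_apply_le_of_norm_sub_left_le (h : IsDichotomyPair V E κ B u v) {f : ℝ → ℂ}
    {L r x : ℝ} (hL : 0 ≤ L) (hr : 0 ≤ r) (hx : 0 ≤ x)
    (hf : ‖f x - u x‖ ≤ L * r * Real.exp (κ * x)) :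
    ‖f x‖ ≤ (B + L) * (Real.exp (-κ * x) + r * Real.exp (κ * x)) := by
  have hB := h.bound_nonneg
  have : 0 ≤ B * (r * Real.exp (κ * x)) + L * Real.exp (-κ * x) := by positivity
  have hu := (norm_apply_le_norm_cauchyData u x).trans (h.norm_left_le_of_nonneg hx)
  have htriangle : ‖f x‖ ≤ ‖f x - u x‖ + ‖u x‖ := by simpa using norm_add_le (f x - u x) (u x)
  linarith

theorem exists_perturbation_bounds (h : IsDichotomyPair V E κ B u v) (a : ℂ) :
    ∃ K, 0 < K ∧ ∃ ε, 0 < ε ∧ ∀ M r : ℝ, 0 ≤ M → 0 ≤ r → M * r ≤ ε →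
      ∀ (z₁ z₂ δ₁ δ₂ : ℂ) (f₁ f₂ : ℝ → ℂ), ‖z₁ - E‖ ≤ r → ‖z₂ - E‖ ≤ r → ‖δ₂‖ ≤ r →
        IsPerturbation V u v a z₁ δ₁ f₁ → IsPerturbation V u v a z₂ δ₂ f₂ →
        ∀ x ∈ Set.Icc 0 M,
          ‖cauchyData f₁ x - cauchyData f₂ x‖
            ≤ K * (‖δ₁ - δ₂‖ + ‖z₁ - z₂‖) * Real.exp (κ * x) ∧
          ‖f₂ x - u x‖ ≤ K * r * Real.exp (κ * x) ∧
          ‖f₂ x‖ ≤ K * (Real.exp (-κ * x) + r * Real.exp (κ * x)) := by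
  have hκ := h.pos
  have hB := h.bound_nonneg
  obtain ⟨L, hLdef⟩ : ∃ L, L = 4 * (B * (‖a‖ + 1) + 2 * B ^ 3 * (1 / (2 * κ) + 1)) := ⟨_, rfl⟩
  have hL : 0 ≤ L := by rw [hLdef]; positivity
  set K := 2 * (B * (‖a‖ + 1) + 2 * B ^ 2 * (B + L) * (1 / (2 * κ) + 1)) with hK
  have hK0 : 0 ≤ K := by positivity
  refine ⟨K + (B + L) + 1, by positivity, min 1 (1 / (4 * B ^ 2 + 1)), by positivity, ?_⟩
  intro M r hM hr hMr z₁ z₂ δ₁ δ₂ f₁ f₂ hz₁ hz₂ hδ₂ hf₁ hf₂ x hx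
  have hMr1 : M * r ≤ 1 := hMr.trans (min_le_left _ _)
  have hBMr : 4 * B ^ 2 * (M * r) ≤ 1 := by
    have := (le_div_iff₀ (by positivity)).1 (hMr.trans (min_le_right _ _))
    linarith [mul_nonneg hM hr]
  have hf₂u := h.norm_sub_left_le hf₂ hM hr hMr1 hBMr hz₂ hδ₂
  rw [← hLdef] at hf₂u
  have hf₂L (t : ℝ) (ht : t ∈ Set.Icc 0 M) :=
    h.norm_apply_le_of_norm_sub_left_le hL hr ht.1 (hf₂u t ht)
  have hsub := h.norm_cauchyData_sub_le hf₁ hf₂ (by positivity) hM hr hMr1 hBMr hz₁ hf₂L x hx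
  rw [← mul_assoc 2, ← hK] at hsub
  refine ⟨hsub.trans ?_, (hf₂u x hx).trans ?_, (hf₂L x hx).trans ?_⟩
  · gcongr
    linarith
  · gcongr
    linarith
  · gcongr ?_ * _
    linarith

theorem norm_integral_mul_le (h : IsDichotomyPair V E κ B u v) {M : ℝ} (hM : 0 ≤ M) :
    ‖∫ t in (0 : ℝ)..M, u t * v t‖ ≤ B ^ 2 * M := by
  have hB := h.bound_nonneg
  have hbound := intervalIntegral.norm_integral_le_of_norm_le_const (a := 0) (b := M)
    (C := B ^ 2) (f := fun t => u t * v t) fun t ht => by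
      have ht0 : 0 ≤ t := ((Set.uIoc_of_le hM).le ht).1.le
      have hut := (norm_apply_le_norm_cauchyData u t).trans (h.norm_left_le_of_nonneg ht0)
      have hvt := (norm_apply_le_norm_cauchyData v t).trans (h.norm_right_le_of_nonneg ht0)
      calc ‖u t * v t‖ ≤ B * Real.exp (-κ * t) * (B * Real.exp (κ * t)) := by
            rw [norm_mul]
            gcongr
        _ = B ^ 2 * Real.exp (-κ * t + κ * t) := by rw [Real.exp_add]; ring
        _ = B ^ 2 := by simp
  rwa [sub_zero, abs_of_nonneg hM] at hbound

/-- Splitting `f₂ = u + (f₂ - u)` in the variation of parameters formula isolates the part linear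
in the parameters. -/
theorem cauchyData_sub_sub_linear_eq (h : IsDichotomyPair V E κ B u v) {a z₁ z₂ δ₁ δ₂ : ℂ}
    {f₁ f₂ : ℝ → ℂ} (hf₁ : IsPerturbation V u v a z₁ δ₁ f₁)
    (hf₂ : IsPerturbation V u v a z₂ δ₂ f₂) (x : ℝ) :
    cauchyData f₁ x - cauchyData f₂ x
        - ((δ₁ - δ₂) - (z₁ - z₂) * ∫ t in (0 : ℝ)..x, u t ^ 2) • cauchyData v x
      = (a * (δ₁ - δ₂) + (z₁ - z₂) * ∫ t in (0 : ℝ)..x, u t * v t) • cauchyData u x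
        - ∫ t in (0 : ℝ)..x, ((z₁ - E) * (f₁ t - f₂ t) + (z₁ - z₂) * (f₂ t - u t)) •
          (u t • cauchyData v x - v t • cauchyData u x) := by
  have := h.isSolution_left.continuous
  have := h.isSolution_right.continuous
  have := hf₁.isSolution.continuous
  have := hf₂.isSolution.continuous
  have hlinear : ∫ t in (0 : ℝ)..x, ((z₁ - z₂) * u t) •
        (u t • cauchyData v x - v t • cauchyData u x)
      = ((z₁ - z₂) * ∫ t in (0 : ℝ)..x, u t ^ 2) • cauchyData v x
        - ((z₁ - z₂) * ∫ t in (0 : ℝ)..x, u t * v t) • cauchyData u x := by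
    rw [← intervalIntegral.integral_const_mul, ← intervalIntegral.integral_const_mul,
      ← intervalIntegral.integral_smul_const, ← intervalIntegral.integral_smul_const,
      ← intervalIntegral.integral_sub (Continuous.intervalIntegrable (by fun_prop) _ _)
        (Continuous.intervalIntegrable (by fun_prop) _ _)]
    exact intervalIntegral.integral_congr fun t _ => by module
  have hsplit : ∫ t in (0 : ℝ)..x, ((z₁ - E) * (f₁ t - f₂ t) + (z₁ - z₂) * f₂ t) •
        (u t • cauchyData v x - v t • cauchyData u x)
      = (∫ t in (0 : ℝ)..x, ((z₁ - E) * (f₁ t - f₂ t) + (z₁ - z₂) * (f₂ t - u t)) •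
          (u t • cauchyData v x - v t • cauchyData u x))
        + ∫ t in (0 : ℝ)..x, ((z₁ - z₂) * u t) •
          (u t • cauchyData v x - v t • cauchyData u x) := by
    rw [← intervalIntegral.integral_add (Continuous.intervalIntegrable (by fun_prop) _ _)
        (Continuous.intervalIntegrable (by fun_prop) _ _)]
    exact intervalIntegral.integral_congr fun t _ => by module
  rw [h.cauchyData_sub_eq hf₁ hf₂, hsplit, hlinear]
  module

theorem norm_mul_add_mul_integral_smul_le (h : IsDichotomyPair V E κ B u v) {M : ℝ} (hM : 1 ≤ M)
    (a δ z : ℂ) :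
    ‖(a * δ + z * ∫ t in (0 : ℝ)..M, u t * v t) • cauchyData u M‖
      ≤ (‖a‖ + B ^ 2) * B * (M * Real.exp (-κ * M)) * (‖δ‖ + ‖z‖) := by
  have hM0 : 0 ≤ M := by linarith
  have := h.bound_nonneg
  calc _ ≤ (‖a‖ * ‖δ‖ + ‖z‖ * ‖∫ t in (0 : ℝ)..M, u t * v t‖) * ‖cauchyData u M‖ := by
        rw [norm_smul]
        gcongr
        exact (norm_add_le _ _).trans (by rw [norm_mul, norm_mul])
    _ ≤ (‖a‖ * (M * (‖δ‖ + ‖z‖)) + (‖δ‖ + ‖z‖) * (B ^ 2 * M)) * (B * Real.exp (-κ * M)) := by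
        gcongr
        · exact (le_mul_of_one_le_left (norm_nonneg _) hM).trans (by gcongr; simp)
        · simp
        · exact h.norm_integral_mul_le hM0
        · exact h.norm_left_le_of_nonneg hM0
    _ = _ := by ring

theorem exists_norm_cauchyData_sub_sub_linear_le (h : IsDichotomyPair V E κ B u v) (a : ℂ) :
    ∃ C, 0 < C ∧ ∃ ε, 0 < ε ∧ ∀ M r : ℝ, 1 ≤ M → 0 ≤ r → M * r ≤ ε →
      ∀ (z₁ z₂ δ₁ δ₂ : ℂ) (f₁ f₂ : ℝ → ℂ), ‖z₁ - E‖ ≤ r → ‖z₂ - E‖ ≤ r → ‖δ₂‖ ≤ r →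
        IsPerturbation V u v a z₁ δ₁ f₁ → IsPerturbation V u v a z₂ δ₂ f₂ →
        ‖cauchyData f₁ M - cauchyData f₂ M
            - ((δ₁ - δ₂) - (z₁ - z₂) * ∫ t in (0 : ℝ)..M, u t ^ 2) • cauchyData v M‖
          ≤ C * (M * (Real.exp (-κ * M) + r * Real.exp (κ * M)))
            * (‖δ₁ - δ₂‖ + ‖z₁ - z₂‖) := by
  have hB := h.bound_nonneg
  obtain ⟨K, hK, ε, hε, hbounds⟩ := h.exists_perturbation_bounds a
  refine ⟨(‖a‖ + B ^ 2) * B + 4 * B ^ 2 * K + 1, by positivity, ε, hε, ?_⟩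
  intro M r hM hr hMr z₁ z₂ δ₁ δ₂ f₁ f₂ hz₁ hz₂ hδ₂ hf₁ hf₂
  have hM0 : 0 ≤ M := by linarith
  have hb := hbounds M r hM0 hr hMr z₁ z₂ δ₁ δ₂ f₁ f₂ hz₁ hz₂ hδ₂ hf₁ hf₂
  have hleft := h.norm_mul_add_mul_integral_smul_le hM a (δ₁ - δ₂) (z₁ - z₂)
  set Δ := ‖δ₁ - δ₂‖ + ‖z₁ - z₂‖
  have hzΔ : ‖z₁ - z₂‖ ≤ Δ := le_add_of_nonneg_left (norm_nonneg _)
  have : 0 ≤ Δ := (norm_nonneg _).trans hzΔ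
  have hintegral := h.norm_integral_greenKernel_le hM0 (G₁ := 0) (G₂ := 2 * K * r * Δ) le_rfl
    (k := fun t => (z₁ - E) * (f₁ t - f₂ t) + (z₁ - z₂) * (f₂ t - u t)) fun t ht =>
      calc _ ≤ ‖z₁ - E‖ * ‖f₁ t - f₂ t‖ + ‖z₁ - z₂‖ * ‖f₂ t - u t‖ := by
            simpa only [norm_mul] using
              norm_add_le ((z₁ - E) * (f₁ t - f₂ t)) ((z₁ - z₂) * (f₂ t - u t))
        _ ≤ r * (K * Δ * Real.exp (κ * t)) + Δ * (K * r * Real.exp (κ * t)) := by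
            gcongr
            exacts [(norm_fst_le (cauchyData f₁ t - cauchyData f₂ t)).trans (hb t ht).1,
              (hb t ht).2.1]
        _ = 0 * Real.exp (-κ * t) + 2 * K * r * Δ * Real.exp (κ * t) := by ring
  rw [zero_div, zero_add] at hintegral
  have : 0 ≤ (‖a‖ + B ^ 2) * B * (M * (r * Real.exp (κ * M))) * Δ
      + 4 * B ^ 2 * K * (M * Real.exp (-κ * M)) * Δ
      + M * (Real.exp (-κ * M) + r * Real.exp (κ * M)) * Δ := by positivity
  rw [h.cauchyData_sub_sub_linear_eq hf₁ hf₂]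
  refine (norm_sub_le _ _).trans ((add_le_add hleft hintegral).trans ?_)
  linarith

theorem exists_norm_outPlus_sub_sub_linear_le (h : IsDichotomyPair V E κ B u v) (hE : 0 < E)
    (a : ℂ) :
    ∃ C, 0 < C ∧ ∃ ε, 0 < ε ∧ ∀ M r : ℝ, 1 ≤ M → 0 ≤ r → M * r ≤ ε →
      ∀ (z₁ z₂ δ₁ δ₂ : ℂ) (f₁ f₂ : ℝ → ℂ), ‖z₁ - E‖ ≤ r → ‖z₂ - E‖ ≤ r → ‖δ₂‖ ≤ r →
        IsPerturbation V u v a z₁ δ₁ f₁ → IsPerturbation V u v a z₂ δ₂ f₂ →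
        ‖outPlus z₁ f₁ M - outPlus z₂ f₂ M
            - outPlus E v M * ((δ₁ - δ₂) - (z₁ - z₂) * ∫ t in (0 : ℝ)..M, u t ^ 2)‖
          ≤ C * (M * (Real.exp (-κ * M) + r * Real.exp (κ * M)))
            * (‖δ₁ - δ₂‖ + ‖z₁ - z₂‖) := by
  obtain ⟨K, hK, ε₁, hε₁, hbounds⟩ := h.exists_perturbation_bounds a
  obtain ⟨C, hC, ε₂, hε₂, hlinear⟩ := h.exists_norm_cauchyData_sub_sub_linear_le a
  set s := Real.sqrt (E / 2)
  refine ⟨(1 + Real.sqrt E) * C + 2 * K / s, by positivity, min (min ε₁ ε₂) (E / 2),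
    by positivity, ?_⟩
  intro M r hM hr hMr z₁ z₂ δ₁ δ₂ f₁ f₂ hz₁ hz₂ hδ₂ hf₁ hf₂
  have hM0 : 0 ≤ M := by linarith
  have hrE : r ≤ E / 2 := (le_mul_of_one_le_left hr hM).trans (hMr.trans (min_le_right _ _))
  have hMr' : M * r ≤ min ε₁ ε₂ := hMr.trans (min_le_left _ _)
  obtain ⟨hsub, -, hf₂M⟩ := hbounds M r hM0 hr (hMr'.trans (min_le_left _ _)) z₁ z₂ δ₁ δ₂ f₁ f₂
    hz₁ hz₂ hδ₂ hf₁ hf₂ M ⟨hM0, le_rfl⟩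
  have hlin := hlinear M r hM hr (hMr'.trans (min_le_right _ _)) z₁ z₂ δ₁ δ₂ f₁ f₂
    hz₁ hz₂ hδ₂ hf₁ hf₂
  have hre : E / 2 ≤ z₁.re := by
    have := (abs_le.1 ((Complex.abs_re_le_norm (z₁ - E)).trans (hz₁.trans hrE))).1
    rw [Complex.sub_re, Complex.ofReal_re] at this
    linarith
  have hcorr := norm_csqrt_sub_mul_add_csqrt_sub_mul_le (z₀ := E) (z₂ := z₂) (by linarith) hre
    (f₁ M - f₂ M) (f₂ M)
  set Δ := ‖δ₁ - δ₂‖ + ‖z₁ - z₂‖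
  have hzΔ : ‖z₁ - z₂‖ ≤ Δ := le_add_of_nonneg_left (norm_nonneg _)
  have : 0 ≤ Δ := (norm_nonneg _).trans hzΔ
  set e := Real.exp (-κ * M) + r * Real.exp (κ * M)
  have hre_le : r * Real.exp (κ * M) ≤ e := le_add_of_nonneg_left (Real.exp_pos _).le
  have : 0 ≤ e := by positivity
  rw [outPlus_sub_sub_mul_eq]
  calc _ ≤ (1 + Real.sqrt E) * (C * (M * e) * Δ) + (r * (K * Δ * Real.exp (κ * M))
        + Δ * (K * e)) / s := by
        refine (norm_sub_le _ _).trans (add_le_add ((norm_outgoingDefect_le hE.le _).trans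
          (by gcongr)) ?_)
        rw [norm_mul, Complex.norm_I, one_mul]
        refine hcorr.trans ?_
        gcongr
        exact (norm_fst_le (cauchyData f₁ M - cauchyData f₂ M)).trans hsub
    _ ≤ (1 + Real.sqrt E) * (C * (M * e) * Δ) + (K * Δ * (M * e) + Δ * (K * (M * e))) / s := by
        have heM : e ≤ M * e := le_mul_of_one_le_left ‹_› hM
        rw [show r * (K * Δ * Real.exp (κ * M)) = K * Δ * (r * Real.exp (κ * M)) by ring]
        gcongr ((1 + Real.sqrt E) * (C * _ * Δ)) + (K * Δ * ?_ + Δ * (K * ?_)) / s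
        exact hre_le.trans heM
    _ = _ := by ring

theorem norm_integral_sq_le (h : IsDichotomyPair V E κ B u v) {M : ℝ} (hM : 0 ≤ M) :
    ‖∫ t in (0 : ℝ)..M, u t ^ 2‖ ≤ B ^ 2 / (2 * κ) := by
  have hexp := integral_exp_mul_sub_mul_le (G₁ := B ^ 2) (G₂ := 0) h.pos (by positivity) M
  have hbound (t : ℝ) (ht : t ∈ Set.Ioc 0 M) : ‖u t ^ 2‖ ≤ Real.exp (-(κ * M))
      * (Real.exp (κ * (M - t)) * (B ^ 2 * Real.exp (-κ * t) + 0 * Real.exp (κ * t))) :=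
    calc ‖u t ^ 2‖ ≤ (B * Real.exp (-κ * t)) ^ 2 := by
          rw [norm_pow]
          gcongr
          exact (norm_apply_le_norm_cauchyData u t).trans (h.norm_left_le_of_nonneg ht.1.le)
      _ = B ^ 2 * (Real.exp (-(κ * M) + κ * (M - t)) * Real.exp (-κ * t)) := by
          rw [show -(κ * M) + κ * (M - t) = -κ * t by ring]
          ring
      _ = _ := by
          rw [Real.exp_add]
          ring
  calc _ ≤ _ := intervalIntegral.norm_integral_le_of_norm_le hM (ae_of_all _ hbound)
        (Continuous.intervalIntegrable (by fun_prop) _ _)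
    _ ≤ Real.exp (-(κ * M)) * (Real.exp (κ * M) * (B ^ 2 / (2 * κ) + 0 * M)) := by
        rw [intervalIntegral.integral_const_mul]
        gcongr
    _ = B ^ 2 / (2 * κ) := by
        rw [← mul_assoc, ← Real.exp_add, neg_add_cancel, Real.exp_zero]
        ring

theorem exp_le_norm_outPlus_right (h : IsDichotomyPair V E κ B u v) (hE : 0 < E) {x : ℝ}
    (hx : 0 ≤ x) (hv : (v x).im = 0) (hv' : (deriv v x).im = 0) :
    Real.exp (κ * x) ≤ 2 * B * (1 + 1 / Real.sqrt E) * ‖outPlus E v x‖ := by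
  have hB := h.bound_nonneg
  have hW : 1 ≤ 2 * (B * Real.exp (-κ * x)) * ((1 + 1 / Real.sqrt E) * ‖outPlus E v x‖) :=
    calc 1 = ‖wronskian u v x‖ := by rw [h.wronskian_eq_one, norm_one]
      _ ≤ 2 * ‖cauchyData u x‖ * ‖cauchyData v x‖ := norm_wronskian_le u v x
      _ ≤ _ := by
          gcongr
          · exact h.norm_left_le_of_nonneg hx
          · exact norm_le_norm_outgoingDefect hE hv hv'
  calc Real.exp (κ * x)
      ≤ 2 * (B * Real.exp (-κ * x)) * ((1 + 1 / Real.sqrt E) * ‖outPlus E v x‖)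
          * Real.exp (κ * x) := le_mul_of_one_le_left (Real.exp_pos _).le hW
    _ = 2 * B * (1 + 1 / Real.sqrt E) * ‖outPlus E v x‖
          * (Real.exp (-κ * x) * Real.exp (κ * x)) := by ring
    _ = _ := by rw [← Real.exp_add, neg_mul, neg_add_cancel, Real.exp_zero, mul_one]

theorem norm_outPlus_left_le (h : IsDichotomyPair V E κ B u v) (hE : 0 ≤ E) {x : ℝ}
    (hx : 0 ≤ x) : ‖outPlus E u x‖ ≤ (1 + Real.sqrt E) * B * Real.exp (-κ * x) := by
  rw [outPlus_eq_outgoingDefect, mul_assoc]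
  refine (norm_outgoingDefect_le hE _).trans ?_
  gcongr
  exact h.norm_left_le_of_nonneg hx

end IsDichotomyPair

/-! ### A quantitative Newton argument -/

theorem exists_unique_zero_of_approx_inverse {X Y F : Type*} [NormedAddCommGroup X]
    [CompleteSpace X] [AddGroup Y] [FunLike F Y X] [AddMonoidHomClass F Y X] {B : F}
    (hB : Function.Injective B) {T : X → Y} {Ω : Set X} (hΩ : IsClosed Ω) {η : X} {r : ℝ}
    (hin : ∀ x, ‖x - η‖ ≤ r / 2 → x ∈ Ω) (hout : ∀ x ∈ Ω, ‖x - η‖ ≤ r)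
    (hBT : ∀ x ∈ Ω, ∀ y ∈ Ω, ‖B (T x - T y) - (x - y)‖ ≤ 1 / 4 * ‖x - y‖)
    (hη : ‖B (T η)‖ ≤ r / 4) :
    ∃ x ∈ Ω, T x = 0 ∧ ‖x - η‖ ≤ 2 * ‖B (T η)‖ ∧ ∀ y ∈ Ω, T y = 0 → y = x := by
  set N : X → X := fun x => x - B (T x)
  have hN : ∀ x ∈ Ω, ∀ y ∈ Ω, ‖N x - N y‖ ≤ 1 / 4 * ‖x - y‖ := fun x hx y hy => by
    rw [show N x - N y = -(B (T x - T y) - (x - y)) by simp only [N, map_sub]; abel, norm_neg]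
    exact hBT x hx y hy
  have hηΩ : η ∈ Ω := hin η (by rw [sub_self, norm_zero]; linarith [norm_nonneg (B (T η))])
  have hNη : ∀ x ∈ Ω, ‖N x - η‖ ≤ ‖B (T η)‖ + 1 / 4 * ‖x - η‖ := fun x hx =>
    calc ‖N x - η‖ = ‖(N x - N η) - B (T η)‖ := by simp only [N]; abel_nf
      _ ≤ ‖N x - N η‖ + ‖B (T η)‖ := norm_sub_le _ _
      _ ≤ _ := by linarith [hN x hx η hηΩ]
  have hmaps : Set.MapsTo N Ω Ω := fun x hx => hin _ (by linarith [hNη x hx, hout x hx])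
  have hcontr : ContractingWith (1 / 4) (hmaps.restrict N Ω Ω) :=
    ⟨by norm_num, LipschitzWith.of_dist_le_mul fun x y => by
      simpa [Subtype.dist_eq, dist_eq_norm] using hN x x.2 y y.2⟩
  obtain ⟨x, hx, hfix, -⟩ := hcontr.exists_fixedPoint' hΩ.isComplete hmaps hηΩ (edist_ne_top _ _)
  have hTx : T x = 0 := hB (by rw [map_zero]; exact sub_eq_self.1 hfix)
  refine ⟨x, hx, hTx, ?_, fun y hy hTy => ?_⟩
  · have := hNη x hx
    rw [hfix] at this
    linarith [norm_nonneg (B (T η))]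
  · have := hN y hy x hx
    simp only [N, hTx, hTy, map_zero, sub_zero] at this
    exact sub_eq_zero.1 (norm_le_zero_iff.1 (by linarith))

/-- The inverse of the linear map `(w, z) ↦ (Aᵣ (w - z Iᵣ), Aₗ (w + z Iₗ))`, which approximates the
increments of `Θ` near `η`; here `Aᵣ, Aₗ` are the outgoing defects of `v` at `M` and `-M`, and
`Iᵣ, Iₗ` the integrals of `u²` over `[0, M]` and `[-M, 0]`. -/
noncomputable def linearizedInverse (Aᵣ Aₗ Iᵣ Iₗ : ℂ) : ℂ × ℂ →ₗ[ℂ] ℂ × ℂ :=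
  (Iₗ + Iᵣ)⁻¹ • LinearMap.prod
    ((Iₗ / Aᵣ) • LinearMap.fst ℂ ℂ ℂ + (Iᵣ / Aₗ) • LinearMap.snd ℂ ℂ ℂ)
    (Aₗ⁻¹ • LinearMap.snd ℂ ℂ ℂ - Aᵣ⁻¹ • LinearMap.fst ℂ ℂ ℂ)

section LinearizedInverse

variable {Aᵣ Aₗ Iᵣ Iₗ : ℂ}

theorem linearizedInverse_apply (g : ℂ × ℂ) :
    linearizedInverse Aᵣ Aₗ Iᵣ Iₗ g
      = ((Iₗ * (g.1 / Aᵣ) + Iᵣ * (g.2 / Aₗ)) / (Iₗ + Iᵣ), (g.2 / Aₗ - g.1 / Aᵣ) / (Iₗ + Iᵣ)) := by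
  ext <;> simp [linearizedInverse] <;> ring

theorem linearizedInverse_linearized (hAᵣ : Aᵣ ≠ 0) (hAₗ : Aₗ ≠ 0) (hI : Iₗ + Iᵣ ≠ 0)
    (x : ℂ × ℂ) :
    linearizedInverse Aᵣ Aₗ Iᵣ Iₗ (Aᵣ * (x.1 - x.2 * Iᵣ), Aₗ * (x.1 + x.2 * Iₗ)) = x := by
  rw [linearizedInverse_apply]
  ext <;> field_simp <;> ring

theorem norm_linearizedInverse_le {β c q : ℝ} (hc : 0 < c) (hI : c ≤ ‖Iₗ + Iᵣ‖)
    (hIᵣ : ‖Iᵣ‖ ≤ β) (hIₗ : ‖Iₗ‖ ≤ β) (hq : 0 ≤ q) {g : ℂ × ℂ} (hg₁ : ‖g.1‖ ≤ q * ‖Aᵣ‖)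
    (hg₂ : ‖g.2‖ ≤ q * ‖Aₗ‖) :
    ‖linearizedInverse Aᵣ Aₗ Iᵣ Iₗ g‖ ≤ 2 * (β + 1) / c * q := by
  have hβ : 0 ≤ β := (norm_nonneg _).trans hIᵣ
  have hdiv₁ : ‖g.1 / Aᵣ‖ ≤ q := by
    rw [norm_div]
    exact div_le_of_le_mul₀ (norm_nonneg _) hq hg₁
  have hdiv₂ : ‖g.2 / Aₗ‖ ≤ q := by
    rw [norm_div]
    exact div_le_of_le_mul₀ (norm_nonneg _) hq hg₂
  have hdiv {x : ℂ} (hx : ‖x‖ ≤ 2 * (β + 1) * q) :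
      ‖x / (Iₗ + Iᵣ)‖ ≤ 2 * (β + 1) / c * q := by
    rw [norm_div, div_mul_eq_mul_div]
    gcongr
  rw [linearizedInverse_apply]
  refine max_le (hdiv ?_) (hdiv ?_)
  · calc ‖Iₗ * (g.1 / Aᵣ) + Iᵣ * (g.2 / Aₗ)‖ ≤ β * q + β * q := by
          refine (norm_add_le _ _).trans ?_
          rw [norm_mul, norm_mul]
          gcongr
      _ ≤ 2 * (β + 1) * q := by linarith
  · calc ‖g.2 / Aₗ - g.1 / Aᵣ‖ ≤ q + q := (norm_sub_le _ _).trans (add_le_add hdiv₂ hdiv₁)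
      _ ≤ 2 * (β + 1) * q := by linarith [mul_nonneg hβ hq]

end LinearizedInverse

/-! ### Resonances -/

theorem hasDerivAt_ite_le {F : Type*} [NormedAddCommGroup F] [NormedSpace ℝ F]
    {f g f' g' : ℝ → F} {a : ℝ} (hf : ∀ x, HasDerivAt f (f' x) x)
    (hg : ∀ x, HasDerivAt g (g' x) x) (hfg : f a = g a) (hfg' : f' a = g' a) (x : ℝ) :
    HasDerivAt (fun x => if x ≤ a then f x else g x) (if x ≤ a then f' x else g' x) x := by
  rcases lt_trichotomy x a with hx | rfl | hx
  · rw [if_pos hx.le]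
    refine (hf x).congr_of_eventuallyEq ?_
    filter_upwards [gt_mem_nhds hx] with t ht using if_pos ht.le
  · have hleft : HasDerivWithinAt (fun t => if t ≤ x then f t else g t) (f' x) (Set.Iic x) x :=
      (hf x).hasDerivWithinAt.congr (fun t ht => if_pos ht) (if_pos le_rfl)
    have hright : HasDerivWithinAt (fun t => if t ≤ x then f t else g t) (f' x) (Set.Ici x) x := by
      rw [hfg']
      refine (hg x).hasDerivWithinAt.congr (fun t ht => ?_) (by rw [if_pos le_rfl, hfg])
      split_ifs with h
      · rw [le_antisymm h ht, hfg]
      · rfl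
    simpa using hleft.union hright
  · rw [if_neg hx.not_ge]
    refine (hg x).congr_of_eventuallyEq ?_
    filter_upwards [lt_mem_nhds hx] with t ht using if_neg ht.not_ge

/-- The extension of the restriction of `f` to `[-M, M]` by a multiple of `exp (-α x)` on the left
and of `exp (α x)` on the right; it is outgoing for the energy `z` when `α = i √z`. -/
noncomputable def outgoingExtension (α : ℂ) (M : ℝ) (f : ℝ → ℂ) (x : ℝ) : ℂ :=
  if x ≤ -M then f (-M) * Complex.exp (-α * (x + M))
  else if x ≤ M then f x else f M * Complex.exp (α * (x - M))

section OutgoingExtension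

variable {α : ℂ} {M x : ℝ} {f : ℝ → ℂ}

theorem outgoingExtension_of_le_neg (α : ℂ) (f : ℝ → ℂ) (hx : x ≤ -M) :
    outgoingExtension α M f x = f (-M) * Complex.exp (-α * (x + M)) :=
  if_pos hx

theorem outgoingExtension_of_abs_lt (α : ℂ) (f : ℝ → ℂ) (hx : |x| < M) :
    outgoingExtension α M f x = f x := by
  rw [abs_lt] at hx
  rw [outgoingExtension, if_neg hx.1.not_ge, if_pos hx.2.le]

theorem outgoingExtension_of_le (α : ℂ) (f : ℝ → ℂ) (hM : 0 < M) (hx : M ≤ x) :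
    outgoingExtension α M f x = f M * Complex.exp (α * (x - M)) := by
  rw [outgoingExtension, if_neg (by linarith)]
  split_ifs with h
  · rw [le_antisymm h hx, sub_self, mul_zero, Complex.exp_zero, mul_one]
  · rfl

theorem outgoingExtension_eventuallyEq_of_abs_lt (α : ℂ) (f : ℝ → ℂ) (hx : |x| < M) :
    outgoingExtension α M f =ᶠ[nhds x] f := by
  filter_upwards [continuous_abs.continuousAt.eventually_lt_const hx] with t ht
  exact outgoingExtension_of_abs_lt α f ht

theorem continuous_outgoingExtension (α : ℂ) (hM : 0 < M) (hf : Continuous f) :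
    Continuous (outgoingExtension α M f) := by
  refine Continuous.if_le (by fun_prop) (Continuous.if_le hf (by fun_prop) continuous_id
    continuous_const ?_) continuous_id continuous_const ?_
  · rintro x rfl
    simp
  · rintro x rfl
    simp [hM.le]

theorem hasDerivAt_const_mul_exp (c α β : ℂ) (x : ℝ) :
    HasDerivAt (fun t : ℝ => c * Complex.exp (α * (t + β)))
      (c * α * Complex.exp (α * (x + β))) x := by
  have h : HasDerivAt (fun t : ℝ => α * ((t : ℂ) + β)) α x := by
    simpa using ((Complex.ofRealCLM.hasDerivAt (x := x)).add_const β).const_mul α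
  exact (h.cexp.const_mul c).congr_deriv (by ring)

theorem hasDerivAt_outgoingExtension (hM : 0 < M) (hf : Differentiable ℝ f)
    (hright : deriv f M = α * f M) (hleft : deriv f (-M) = -α * f (-M)) (x : ℝ) :
    HasDerivAt (outgoingExtension α M f) (outgoingExtension α M (deriv f) x) x := by
  have hexp_left (t : ℝ) : HasDerivAt (fun t : ℝ => f (-M) * Complex.exp (-α * (t + M)))
      (deriv f (-M) * Complex.exp (-α * (t + M))) t := by
    rw [hleft, mul_comm (-α)]
    exact hasDerivAt_const_mul_exp (f (-M)) (-α) M t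
  have hexp_right (t : ℝ) : HasDerivAt (fun t : ℝ => f M * Complex.exp (α * (t - M)))
      (deriv f M * Complex.exp (α * (t - M))) t := by
    rw [hright, mul_comm α]
    exact hasDerivAt_const_mul_exp (f M) α (-M) t
  exact hasDerivAt_ite_le hexp_left (hasDerivAt_ite_le (fun t => (hf t).hasDerivAt) hexp_right
    (by simp) (by simp)) (by simp [hM.le]) (by simp [hM.le]) x

theorem deriv_outgoingExtension (hM : 0 < M) (hf : Differentiable ℝ f)
    (hright : deriv f M = α * f M) (hleft : deriv f (-M) = -α * f (-M)) :
    deriv (outgoingExtension α M f) = outgoingExtension α M (deriv f) :=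
  funext fun x => (hasDerivAt_outgoingExtension hM hf hright hleft x).deriv

theorem contDiff_outgoingExtension (hM : 0 < M) (hf : ContDiff ℝ 1 f)
    (hright : deriv f M = α * f M) (hleft : deriv f (-M) = -α * f (-M)) :
    ContDiff ℝ 1 (outgoingExtension α M f) := by
  obtain ⟨hdiff, hcont⟩ := contDiff_one_iff_deriv.1 hf
  refine contDiff_one_iff_deriv.2
    ⟨fun x => (hasDerivAt_outgoingExtension hM hdiff hright hleft x).differentiableAt, ?_⟩
  rw [deriv_outgoingExtension hM hdiff hright hleft]
  exact continuous_outgoingExtension α hM hcont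

theorem hasDerivAt_outgoingExtension_deriv_of_lt_abs (hM : 0 < M)
    (hright : deriv f M = α * f M) (hleft : deriv f (-M) = -α * f (-M)) (hx : M < |x|) :
    HasDerivAt (outgoingExtension α M (deriv f)) (α ^ 2 * outgoingExtension α M f x) x := by
  rcases lt_abs.1 hx with hx | hx
  · have heq : outgoingExtension α M (deriv f) =ᶠ[nhds x]
        fun t => α * f M * Complex.exp (α * (t + (-M : ℝ))) := by
      filter_upwards [lt_mem_nhds hx] with t ht
      rw [outgoingExtension_of_le α _ hM ht.le, hright, Complex.ofReal_neg, ← sub_eq_add_neg]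
    refine ((hasDerivAt_const_mul_exp (α * f M) α (-M : ℝ) x).congr_of_eventuallyEq
      heq).congr_deriv ?_
    rw [outgoingExtension_of_le α _ hM hx.le, Complex.ofReal_neg, ← sub_eq_add_neg]
    ring
  · have hx : x < -M := by linarith
    have heq : outgoingExtension α M (deriv f) =ᶠ[nhds x]
        fun t => -α * f (-M) * Complex.exp (-α * (t + M)) := by
      filter_upwards [gt_mem_nhds hx] with t ht
      rw [outgoingExtension_of_le_neg α _ ht.le, hleft]
    refine ((hasDerivAt_const_mul_exp (-α * f (-M)) (-α) M x).congr_of_eventuallyEq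
      heq).congr_deriv ?_
    rw [outgoingExtension_of_le_neg α _ hx.le]
    ring

end OutgoingExtension

section Outgoing

variable {V : ℝ → ℝ} {z : ℂ} {f : ℝ → ℂ} {M : ℝ}

theorem deriv_eq_of_outPlus_eq_zero (h : outPlus z f M = 0) :
    deriv f M = Complex.I * csqrt z * f M :=
  sub_eq_zero.1 h

theorem deriv_eq_of_outMinus_eq_zero (h : outMinus z f M = 0) :
    deriv f (-M) = -(Complex.I * csqrt z) * f (-M) := by
  rw [neg_mul]
  exact eq_neg_of_add_eq_zero_left h

theorem IsSchrodingerSolution.hasDerivAt_deriv_outgoingExtension (hM : 0 < M)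
    (hf : IsSchrodingerSolution V z f) (hright : outPlus z f M = 0) (hleft : outMinus z f M = 0)
    {x : ℝ} (hx : |x| ≠ M) :
    HasDerivAt (deriv (outgoingExtension (Complex.I * csqrt z) M f))
      (((Vtrunc V M x : ℂ) - z) * outgoingExtension (Complex.I * csqrt z) M f x) x := by
  have hright' := deriv_eq_of_outPlus_eq_zero hright
  have hleft' := deriv_eq_of_outMinus_eq_zero hleft
  rw [deriv_outgoingExtension hM hf.1 hright' hleft']
  rcases hx.lt_or_gt with hx | hx
  · rw [Vtrunc, if_pos hx.le, outgoingExtension_of_abs_lt _ _ hx]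
    exact (hf.2 x).congr_of_eventuallyEq (outgoingExtension_eventuallyEq_of_abs_lt _ _ hx)
  · rw [Vtrunc, if_neg hx.not_ge, Complex.ofReal_zero, zero_sub, ← csqrt_sq z, ← neg_one_mul,
      ← Complex.I_sq, ← mul_pow, csqrt_sq]
    exact hasDerivAt_outgoingExtension_deriv_of_lt_abs hM hright' hleft' hx

theorem IsSchrodingerSolution.im_mul_integral_normSq (hf : IsSchrodingerSolution V z f)
    (hright : outPlus z f M = 0) (hleft : outMinus z f M = 0) :
    z.im * ∫ t in (-M)..M, Complex.normSq (f t)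
      = -(csqrt z).re * (Complex.normSq (f M) + Complex.normSq (f (-M))) := by
  have hflux := hf.conj.wronskian_sub hf (-M) M
  simp only [wronskian, hf.deriv_conj, deriv_eq_of_outPlus_eq_zero hright,
    deriv_eq_of_outMinus_eq_zero hleft, map_mul, map_neg, Complex.conj_I,
    ← Complex.normSq_eq_conj_mul_self, intervalIntegral.integral_ofReal] at hflux
  have hsqrt := Complex.add_conj (csqrt z)
  have hz := Complex.sub_conj z
  apply Complex.ofReal_injective
  push_cast at hsqrt hz ⊢
  rw [Complex.normSq_eq_conj_mul_self, Complex.normSq_eq_conj_mul_self]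
  set J : ℂ := ((∫ t in (-M)..M, Complex.normSq (f t) : ℝ) : ℂ)
  set N : ℂ := starRingEnd ℂ (f M) * f M + starRingEnd ℂ (f (-M)) * f (-M)
  linear_combination (-Complex.I / 2) * hflux + Complex.I * J / 2 * hz
    + Complex.I ^ 2 * N / 2 * hsqrt + (z.im * J + (csqrt z).re * N) * Complex.I_sq

theorem im_neg_of_outgoing (hV : Continuous V) (hM : 0 < M) (hf : IsSchrodingerSolution V z f)
    (hne : f ≠ 0) (hz : 0 < z.re) (hright : outPlus z f M = 0) (hleft : outMinus z f M = 0) :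
    z.im < 0 := by
  have hflux := hf.im_mul_integral_normSq hright hleft
  have hsqrt : 0 < (csqrt z).re := (Real.sqrt_pos.2 hz).trans_le (sqrt_le_csqrt_re le_rfl)
  have hfM : f M ≠ 0 := fun h => by
    refine hne (hf.eq_of_cauchyData_eq (x₀ := M) hV (.zero V z) ?_)
    simp [cauchyData, deriv_eq_of_outPlus_eq_zero hright, h]
  have hint_nonneg : 0 ≤ ∫ t in (-M)..M, Complex.normSq (f t) :=
    intervalIntegral.integral_nonneg (by linarith) fun t _ => Complex.normSq_nonneg _
  have hpos : 0 < (csqrt z).re * (Complex.normSq (f M) + Complex.normSq (f (-M))) :=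
    mul_pos hsqrt (add_pos_of_pos_of_nonneg (Complex.normSq_pos.2 hfM) (Complex.normSq_nonneg _))
  by_contra! him
  linarith [mul_nonneg him hint_nonneg]

theorem isResonance_of_outgoing (hV : Continuous V) (hM : 0 < M)
    (hf : IsSchrodingerSolution V z f) (hne : f ≠ 0) (hz : 0 < z.re)
    (hright : outPlus z f M = 0) (hleft : outMinus z f M = 0) : IsResonance V M z := by
  refine ⟨hz, im_neg_of_outgoing hV hM hf hne hz hright hleft,
    outgoingExtension (Complex.I * csqrt z) M f, fun h => hne ?_, ?_,
    fun x hx => hf.hasDerivAt_deriv_outgoingExtension hM hright hleft hx,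
    ⟨f M * Complex.exp (-(Complex.I * csqrt z * M)), fun x hx => ?_⟩,
    ⟨f (-M) * Complex.exp (-(Complex.I * csqrt z * M)), fun x hx => ?_⟩⟩
  · have hzero := outgoingExtension_eventuallyEq_of_abs_lt (x := 0) (Complex.I * csqrt z) f
      (by simpa using hM)
    rw [h] at hzero
    exact hf.eq_zero_of_eventually_eq_zero hV hzero.symm
  · exact contDiff_outgoingExtension hM (contDiff_one_iff_deriv.2 ⟨hf.1, hf.continuous_deriv⟩)
      (deriv_eq_of_outPlus_eq_zero hright) (deriv_eq_of_outMinus_eq_zero hleft)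
  · rw [outgoingExtension_of_le _ _ hM hx, mul_assoc (f M), ← Complex.exp_add]
    congr 2
    ring
  · rw [outgoingExtension_of_le_neg _ _ hx, mul_assoc (f (-M)), ← Complex.exp_add]
    congr 2
    ring

end Outgoing

/-! ### The solutions `u_ζ` and `v_ζ` -/

section USolVSol

variable {V : ℝ → ℝ} {Φ : ℝ → ℂ} {E : ℝ}

theorem isSchrodingerSolution_uSol (hV : Continuous V) (Φ : ℝ → ℂ) (ζ : ℂ × ℂ) :
    IsSchrodingerSolution V ζ.2 (uSol V Φ ζ) := by
  unfold uSol
  split_ifs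
  · exact (ivpSolution_spec hV _ _ _).1
  · exact (ivpSolution_spec hV _ _ _).1

theorem isSchrodingerSolution_vSol (hV : Continuous V) (Φ : ℝ → ℂ) (ζ : ℂ × ℂ) :
    IsSchrodingerSolution V ζ.2 (vSol V Φ ζ) := by
  unfold vSol
  split_ifs
  · exact (ivpSolution_spec hV _ _ _).1
  · exact (ivpSolution_spec hV _ _ _).1

open Classical in
theorem cauchyData_uSol_zero (hV : Continuous V) (Φ : ℝ → ℂ) (ζ : ℂ × ℂ) :
    cauchyData (uSol V Φ ζ) 0 = if Φ 0 ≠ 0 then (1, ζ.1) else (-ζ.1, 1) := by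
  unfold uSol
  split_ifs
  · exact (ivpSolution_spec hV _ _ _).2
  · exact (ivpSolution_spec hV _ _ _).2

open Classical in
theorem cauchyData_vSol_zero (hV : Continuous V) (Φ : ℝ → ℂ) (ζ : ℂ × ℂ) :
    cauchyData (vSol V Φ ζ) 0 =
      if Φ 0 ≠ 0 then (-ζ.1 / (1 + ζ.1 ^ 2), 1 / (1 + ζ.1 ^ 2))
      else (-1 / (1 + ζ.1 ^ 2), -ζ.1 / (1 + ζ.1 ^ 2)) := by
  unfold vSol
  split_ifs
  · exact (ivpSolution_spec hV _ _ _).2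
  · exact (ivpSolution_spec hV _ _ _).2

theorem wronskian_uSol_vSol_zero (hV : Continuous V) (Φ : ℝ → ℂ) {ζ : ℂ × ℂ}
    (hζ : 1 + ζ.1 ^ 2 ≠ 0) : wronskian (uSol V Φ ζ) (vSol V Φ ζ) 0 = 1 := by
  have hu := cauchyData_uSol_zero hV Φ ζ
  have hv := cauchyData_vSol_zero hV Φ ζ
  split_ifs at hu hv
  all_goals
    rw [cauchyData, Prod.mk.injEq] at hu hv
    rw [wronskian, hu.1, hu.2, hv.1, hv.2]
    field_simp
    ring

theorem isPerturbation_uSol (hV : Continuous V) (Φ : ℝ → ℂ) {η : ℂ × ℂ}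
    (hη : 1 + η.1 ^ 2 ≠ 0) (ζ : ℂ × ℂ) :
    IsPerturbation V (uSol V Φ η) (vSol V Φ η) (η.1 / (1 + η.1 ^ 2)) ζ.2 (ζ.1 - η.1)
      (uSol V Φ ζ) where
  isSolution := isSchrodingerSolution_uSol hV Φ ζ
  cauchyData_zero := by
    rw [cauchyData_uSol_zero hV, cauchyData_uSol_zero hV, cauchyData_vSol_zero hV]
    split_ifs
    all_goals
      ext
      all_goals
        simp only [Prod.fst_add, Prod.snd_add, Prod.smul_fst, Prod.smul_snd, smul_eq_mul]
        field_simp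
        ring

theorem uSol_ne_zero (hV : Continuous V) (Φ : ℝ → ℂ) (ζ : ℂ × ℂ) : uSol V Φ ζ ≠ 0 := fun h => by
  have hdata := cauchyData_uSol_zero hV Φ ζ
  split_ifs at hdata <;> simp [h, cauchyData] at hdata

theorem uSol_etaVec (hV : Continuous V) (hΦ : IsSchrodingerSolution V E Φ)
    (hnorm : Φ 0 = 1 ∨ (Φ 0 = 0 ∧ deriv Φ 0 = 1)) : uSol V Φ (etaVec Φ E) = Φ := by
  refine (isSchrodingerSolution_uSol hV Φ (etaVec Φ E)).eq_of_cauchyData_eq (x₀ := 0) hV hΦ ?_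
  rw [cauchyData_uSol_zero hV]
  rcases hnorm with h | ⟨h, h'⟩
  · simp [cauchyData, etaVec, wZero, h]
  · simp [cauchyData, etaVec, wZero, h, h']

theorem wronskian_eq_zero_of_tendsto {z : ℂ} {f g : ℝ → ℂ} (hf : IsSchrodingerSolution V z f)
    (hg : IsSchrodingerSolution V z g)
    (hf' : Filter.Tendsto (cauchyData f) Filter.atTop (nhds 0))
    (hg' : Filter.Tendsto (cauchyData g) Filter.atTop (nhds 0)) (x : ℝ) : wronskian f g x = 0 := by
  have hbound := (hf'.norm.const_mul 2).mul hg'.norm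
  rw [norm_zero, mul_zero] at hbound
  refine tendsto_nhds_unique (tendsto_const_nhds.congr fun y => hf.wronskian_eq hg y x)
    (squeeze_zero_norm (norm_wronskian_le f g) hbound)

theorem tendsto_cauchyData_of_norm_le {κ C : ℝ} (hκ : 0 < κ)
    (h : ∀ x, ‖cauchyData Φ x‖ ≤ C * Real.exp (-κ * |x|)) :
    Filter.Tendsto (cauchyData Φ) Filter.atTop (nhds 0) := by
  refine squeeze_zero_norm h ?_
  have hlin : Filter.Tendsto (fun x : ℝ => -κ * |x|) Filter.atTop Filter.atBot :=
    Filter.tendsto_abs_atTop_atTop.const_mul_atTop_of_neg (neg_lt_zero.2 hκ)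
  simpa using (Real.tendsto_exp_atBot.comp hlin).const_mul C

theorem im_wZero_eq_zero (hΦ : IsSchrodingerSolution V E Φ)
    (hdecay : Filter.Tendsto (cauchyData Φ) Filter.atTop (nhds 0))
    (hnorm : Φ 0 = 1 ∨ (Φ 0 = 0 ∧ deriv Φ 0 = 1)) : (wZero Φ).im = 0 := by
  rcases hnorm with h | ⟨h, -⟩
  · have hconj := hΦ.conj
    rw [Complex.conj_ofReal] at hconj
    have hdecay' :
        Filter.Tendsto (cauchyData fun t => starRingEnd ℂ (Φ t)) Filter.atTop (nhds 0) := by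
      rw [funext hΦ.cauchyData_conj, ← star_zero]
      exact hdecay.star
    have hW := wronskian_eq_zero_of_tendsto hΦ hconj hdecay hdecay' 0
    rw [wronskian, hΦ.deriv_conj, h, map_one, one_mul, mul_one, sub_eq_zero] at hW
    simpa [wZero, h] using Complex.conj_eq_iff_im.1 hW
  · simp [wZero, h]

theorem one_add_wZero_sq_ne_zero (hw : (wZero Φ).im = 0) : 1 + wZero Φ ^ 2 ≠ 0 := by
  rw [← Complex.re_add_im (wZero Φ), hw, Complex.ofReal_zero, zero_mul, add_zero]
  exact_mod_cast (by positivity : 0 < 1 + (wZero Φ).re ^ 2).ne'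

theorem IsSchrodingerSolution.im_eq_zero {f : ℝ → ℂ} (hV : Continuous V)
    (hf : IsSchrodingerSolution V E f) (h₀ : star (cauchyData f 0) = cauchyData f 0)
    (x : ℝ) : (f x).im = 0 ∧ (deriv f x).im = 0 := by
  have hconj := hf.conj
  rw [Complex.conj_ofReal] at hconj
  have heq : (fun t => starRingEnd ℂ (f t)) = f :=
    hconj.eq_of_cauchyData_eq hV hf ((hf.cauchyData_conj 0).trans h₀)
  exact ⟨Complex.conj_eq_iff_im.1 (congrFun heq x),
    Complex.conj_eq_iff_im.1 (by rw [← hf.deriv_conj, heq])⟩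

theorem im_uSol_etaVec (hV : Continuous V) (hw : (wZero Φ).im = 0) (x : ℝ) :
    (uSol V Φ (etaVec Φ E) x).im = 0 := by
  refine ((isSchrodingerSolution_uSol hV Φ (etaVec Φ E)).im_eq_zero hV ?_ x).1
  rw [cauchyData_uSol_zero hV]
  split_ifs <;> simp [etaVec, Prod.ext_iff, Complex.conj_eq_iff_im.2 hw]

theorem im_vSol_etaVec (hV : Continuous V) (hw : (wZero Φ).im = 0) (x : ℝ) :
    (vSol V Φ (etaVec Φ E) x).im = 0 ∧ (deriv (vSol V Φ (etaVec Φ E)) x).im = 0 := by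
  refine (isSchrodingerSolution_vSol hV Φ (etaVec Φ E)).im_eq_zero hV ?_ x
  rw [cauchyData_vSol_zero hV]
  split_ifs <;> simp [etaVec, Prod.ext_iff, Complex.conj_eq_iff_im.2 hw]

theorem IsBoundState.exists_isDichotomyPair {W : ℝ → ℝ} {ρ : ℝ} (hV : Continuous V)
    (hVW : ∀ x, ρ < |x| → V x = W x) (hper : Function.Periodic W 1) (hΦ : IsBoundState V E Φ)
    (hnorm : Φ 0 = 1 ∨ (Φ 0 = 0 ∧ deriv Φ 0 = 1)) :
    ∃ κ, IsFloquetExponent W E κ ∧ (wZero Φ).im = 0 ∧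
      ∃ B, IsDichotomyPair V E κ B (uSol V Φ (etaVec Φ E)) (vSol V Φ (etaVec Φ E)) := by
  obtain ⟨κ, hκ, ⟨C₁, hC₁⟩, hgrowth⟩ := hΦ.exists_isFloquetExponent hV hVW hper
  have hv := isSchrodingerSolution_vSol hV Φ (etaVec Φ E)
  obtain ⟨C₂, hC₂⟩ := hgrowth _ hv
  have hw := im_wZero_eq_zero hΦ.2.2 (tendsto_cauchyData_of_norm_le hκ.1 hC₁) hnorm
  refine ⟨κ, hκ, hw, max C₁ C₂, hκ.1, isSchrodingerSolution_uSol hV Φ _, hv,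
    wronskian_uSol_vSol_zero hV Φ (one_add_wZero_sq_ne_zero hw), fun x => ?_, fun x => ?_⟩
  · rw [uSol_etaVec hV hΦ.2.2 hnorm]
    exact (hC₁ x).trans (by gcongr; exact le_max_left _ _)
  · exact (hC₂ x).trans (by gcongr; exact le_max_right _ _)

theorem isResonance_of_theta_eq_zero {M : ℝ} {ζ : ℂ × ℂ} (hV : Continuous V) (hM : 0 < M)
    (hζ : 0 < ζ.2.re) (hroot : Theta V Φ M ζ = 0) : IsResonance V M ζ.2 :=
  isResonance_of_outgoing hV hM (isSchrodingerSolution_uSol hV Φ ζ) (uSol_ne_zero hV Φ ζ) hζ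
    (congrArg Prod.fst hroot) (congrArg Prod.snd hroot)

end USolVSol

/-! ### Comparison of the outgoing defects at both ends -/

theorem outMinus_eq_outPlus_neg_comp_neg (z : ℂ) (f : ℝ → ℂ) (x : ℝ) :
    outMinus z f x = outPlus z (fun t => -f (-t)) x := by
  rw [outMinus_eq_neg_outPlus_comp_neg, outPlus, outPlus, deriv.fun_neg]
  ring

namespace IsDichotomyPair

variable {V : ℝ → ℝ} {E κ B : ℝ} {u v : ℝ → ℂ}

theorem exp_le_norm_outMinus_right (h : IsDichotomyPair V E κ B u v) (hE : 0 < E) {x : ℝ}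
    (hx : 0 ≤ x) (hv : (v (-x)).im = 0) (hv' : (deriv v (-x)).im = 0) :
    Real.exp (κ * x) ≤ 2 * B * (1 + 1 / Real.sqrt E) * ‖outMinus E v x‖ := by
  rw [outMinus_eq_outPlus_neg_comp_neg]
  refine h.comp_neg.exp_le_norm_outPlus_right hE hx ?_ ?_
  · rw [Complex.neg_im, hv, neg_zero]
  · rwa [deriv.fun_neg, deriv_comp_neg, neg_neg]

theorem norm_outMinus_left_le (h : IsDichotomyPair V E κ B u v) (hE : 0 ≤ E) {x : ℝ}
    (hx : 0 ≤ x) : ‖outMinus E u x‖ ≤ (1 + Real.sqrt E) * B * Real.exp (-κ * x) := by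
  rw [outMinus_eq_neg_outPlus_comp_neg, norm_neg]
  exact h.comp_neg.norm_outPlus_left_le hE hx

theorem norm_integral_neg_sq_le (h : IsDichotomyPair V E κ B u v) {M : ℝ} (hM : 0 ≤ M) :
    ‖∫ t in (-M)..0, u t ^ 2‖ ≤ B ^ 2 / (2 * κ) := by
  have hreflect := h.comp_neg.norm_integral_sq_le hM
  rwa [intervalIntegral.integral_comp_neg fun t => u t ^ 2, neg_zero] at hreflect

theorem exists_norm_outMinus_sub_sub_linear_le (h : IsDichotomyPair V E κ B u v) (hE : 0 < E)
    (a : ℂ) :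
    ∃ C, 0 < C ∧ ∃ ε, 0 < ε ∧ ∀ M r : ℝ, 1 ≤ M → 0 ≤ r → M * r ≤ ε →
      ∀ (z₁ z₂ δ₁ δ₂ : ℂ) (f₁ f₂ : ℝ → ℂ), ‖z₁ - E‖ ≤ r → ‖z₂ - E‖ ≤ r → ‖δ₂‖ ≤ r →
        IsPerturbation V u v a z₁ δ₁ f₁ → IsPerturbation V u v a z₂ δ₂ f₂ →
        ‖outMinus z₁ f₁ M - outMinus z₂ f₂ M
            - outMinus E v M * ((δ₁ - δ₂) + (z₁ - z₂) * ∫ t in (-M)..0, u t ^ 2)‖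
          ≤ C * (M * (Real.exp (-κ * M) + r * Real.exp (κ * M)))
            * (‖δ₁ - δ₂‖ + ‖z₁ - z₂‖) := by
  obtain ⟨C, hC, ε, hε, hlinear⟩ := h.comp_neg.exists_norm_outPlus_sub_sub_linear_le hE (-a)
  refine ⟨C, hC, ε, hε, fun M r hM hr hMr z₁ z₂ δ₁ δ₂ f₁ f₂ hz₁ hz₂ hδ₂ hf₁ hf₂ => ?_⟩
  have hreflect := hlinear M r hM hr hMr z₁ z₂ (-δ₁) (-δ₂) _ _ hz₁ hz₂ (by rwa [norm_neg])
    hf₁.comp_neg hf₂.comp_neg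
  rw [intervalIntegral.integral_comp_neg fun t => u t ^ 2, neg_zero,
    ← outMinus_eq_outPlus_neg_comp_neg, show -δ₁ - -δ₂ = -(δ₁ - δ₂) by ring,
    norm_neg (δ₁ - δ₂)] at hreflect
  rw [outMinus_eq_neg_outPlus_comp_neg z₁, outMinus_eq_neg_outPlus_comp_neg z₂, ← norm_neg]
  refine le_of_eq_of_le (congrArg norm ?_) hreflect
  ring

end IsDichotomyPair

theorem exists_le_norm_integral_sq {f : ℝ → ℂ} (hf : Continuous f) (him : ∀ t, (f t).im = 0)
    (hne : ¬f =ᶠ[nhds 0] 0) :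
    ∃ c, 0 < c ∧ ∀ M, 1 ≤ M → c ≤ ‖∫ t in (-M)..M, f t ^ 2‖ := by
  have hcont : Continuous fun t => (f t).re ^ 2 := (Complex.continuous_re.comp hf).pow 2
  have hreal (t : ℝ) : f t = ((f t).re : ℂ) := Complex.ext rfl (him t)
  have hsq (M : ℝ) : ∫ t in (-M)..M, f t ^ 2 = ((∫ t in (-M)..M, (f t).re ^ 2 : ℝ) : ℂ) := by
    rw [← intervalIntegral.integral_ofReal]
    exact intervalIntegral.integral_congr fun t _ => by
      rw [Complex.ofReal_pow, ← hreal t]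
  refine ⟨∫ t in (-1 : ℝ)..1, (f t).re ^ 2, ?_, fun M hM => ?_⟩
  · refine intervalIntegral.integral_pos (by norm_num) hcont.continuousOn
      (fun t _ => sq_nonneg _) ?_
    by_contra! hzero
    refine hne ?_
    filter_upwards [Icc_mem_nhds neg_one_lt_zero one_pos] with t ht
    rw [hreal t, pow_eq_zero_iff two_ne_zero |>.1 ((hzero t ht).antisymm (sq_nonneg _))]
    rfl
  · rw [hsq, Complex.norm_real]
    exact (intervalIntegral.integral_mono_interval (by linarith) (by norm_num) hM
      (Filter.Eventually.of_forall fun t => sq_nonneg _) (hcont.intervalIntegrable _ _)).trans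
      (le_abs_self _)

/-! ### Inverting the linearization of `Θ` -/

/-- The approximate inverse of `Θ` near `η` with which Newton's method is run: the inverse of the
linearization `(w, z) ↦ (A₊ (w - z ∫₀ᴹ u_η²), A₋ (w + z ∫₋ᴹ⁰ u_η²))`. -/
noncomputable def thetaInverse (V : ℝ → ℝ) (Φ : ℝ → ℂ) (E M : ℝ) : ℂ × ℂ →ₗ[ℂ] ℂ × ℂ :=
  linearizedInverse (outPlus E (vSol V Φ (etaVec Φ E)) M) (outMinus E (vSol V Φ (etaVec Φ E)) M)
    (uSqInt V Φ E 0 M) (uSqInt V Φ E (-M) 0)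

section ThetaInverse

variable {V : ℝ → ℝ} {Φ : ℝ → ℂ} {E κ B M : ℝ}

theorem exists_exp_le_mul_norm_defect_vSol (hV : Continuous V) (hE : 0 < E)
    (hw : (wZero Φ).im = 0)
    (h : IsDichotomyPair V E κ B (uSol V Φ (etaVec Φ E)) (vSol V Φ (etaVec Φ E))) :
    ∃ c, 0 ≤ c ∧ ∀ M, 0 ≤ M →
      Real.exp (κ * M) ≤ c * ‖outPlus E (vSol V Φ (etaVec Φ E)) M‖ ∧
      Real.exp (κ * M) ≤ c * ‖outMinus E (vSol V Φ (etaVec Φ E)) M‖ := by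
  have hreal := im_vSol_etaVec (E := E) hV hw
  have := h.bound_nonneg
  exact ⟨2 * B * (1 + 1 / Real.sqrt E), by positivity, fun M hM =>
    ⟨h.exp_le_norm_outPlus_right hE hM (hreal M).1 (hreal M).2,
      h.exp_le_norm_outMinus_right hE hM (hreal (-M)).1 (hreal (-M)).2⟩⟩

theorem defect_vSol_ne_zero (hV : Continuous V) (hE : 0 < E) (hw : (wZero Φ).im = 0)
    (h : IsDichotomyPair V E κ B (uSol V Φ (etaVec Φ E)) (vSol V Φ (etaVec Φ E)))
    (hM : 0 ≤ M) :
    outPlus E (vSol V Φ (etaVec Φ E)) M ≠ 0 ∧ outMinus E (vSol V Φ (etaVec Φ E)) M ≠ 0 := by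
  obtain ⟨c, -, hc⟩ := exists_exp_le_mul_norm_defect_vSol hV hE hw h
  have ne_zero {A : ℂ} (hA : Real.exp (κ * M) ≤ c * ‖A‖) : A ≠ 0 := fun hzero =>
    (Real.exp_pos (κ * M)).not_ge (by simpa only [hzero, norm_zero, mul_zero] using hA)
  exact ⟨ne_zero (hc M hM).1, ne_zero (hc M hM).2⟩

theorem uSqInt_add_uSqInt (hV : Continuous V) (a b c : ℝ) :
    uSqInt V Φ E a b + uSqInt V Φ E b c = uSqInt V Φ E a c := by
  have hcont : Continuous fun t => uSol V Φ (etaVec Φ E) t ^ 2 :=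
    (isSchrodingerSolution_uSol hV Φ (etaVec Φ E)).continuous.pow 2
  exact intervalIntegral.integral_add_adjacent_intervals (hcont.intervalIntegrable _ _)
    (hcont.intervalIntegrable _ _)

theorem exists_le_norm_uSqInt (hV : Continuous V) (hw : (wZero Φ).im = 0) :
    ∃ c, 0 < c ∧ ∀ M, 1 ≤ M → c ≤ ‖uSqInt V Φ E (-M) M‖ := by
  have hu := isSchrodingerSolution_uSol hV Φ (etaVec Φ E)
  exact exists_le_norm_integral_sq hu.continuous (im_uSol_etaVec hV hw) fun hzero =>
    uSol_ne_zero hV Φ (etaVec Φ E) (hu.eq_zero_of_eventually_eq_zero hV hzero)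

theorem uSqInt_ne_zero (hV : Continuous V) (hw : (wZero Φ).im = 0) (hM : 1 ≤ M) :
    uSqInt V Φ E (-M) M ≠ 0 := by
  obtain ⟨c, hc, hle⟩ := exists_le_norm_uSqInt (E := E) hV hw
  exact norm_pos_iff.1 (hc.trans_le (hle M hM))

theorem corrDenom_ne_zero (hV : Continuous V) (hE : 0 < E) (hw : (wZero Φ).im = 0)
    (h : IsDichotomyPair V E κ B (uSol V Φ (etaVec Φ E)) (vSol V Φ (etaVec Φ E)))
    (hM : 1 ≤ M) : corrDenom V Φ E M ≠ 0 := by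
  obtain ⟨hAᵣ, hAₗ⟩ := defect_vSol_ne_zero hV hE hw h (zero_le_one.trans hM)
  exact mul_ne_zero (mul_ne_zero (uSqInt_ne_zero hV hw hM) hAᵣ) hAₗ

theorem thetaInverse_linearized (hV : Continuous V) (h : corrDenom V Φ E M ≠ 0) (x : ℂ × ℂ) :
    thetaInverse V Φ E M
      (outPlus E (vSol V Φ (etaVec Φ E)) M * (x.1 - x.2 * uSqInt V Φ E 0 M),
        outMinus E (vSol V Φ (etaVec Φ E)) M * (x.1 + x.2 * uSqInt V Φ E (-M) 0)) = x :=
  linearizedInverse_linearized (right_ne_zero_of_mul (left_ne_zero_of_mul h))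
    (right_ne_zero_of_mul h)
    (uSqInt_add_uSqInt hV (-M) 0 M ▸ left_ne_zero_of_mul (left_ne_zero_of_mul h)) x

theorem thetaInverse_injective (hV : Continuous V) (h : corrDenom V Φ E M ≠ 0) :
    Function.Injective (thetaInverse V Φ E M) :=
  LinearMap.injective_iff_surjective.2 fun x => ⟨_, thetaInverse_linearized hV h x⟩

theorem approx_eq_sub_thetaInverse (hV : Continuous V) (h : corrDenom V Φ E M ≠ 0) :
    (wApprox V Φ E M, zApprox V Φ E M)
      = etaVec Φ E - thetaInverse V Φ E M (Theta V Φ M (etaVec Φ E)) := by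
  rw [thetaInverse, linearizedInverse_apply, uSqInt_add_uSqInt hV, wApprox, zApprox]
  have hAₗ := right_ne_zero_of_mul h
  have hAᵣ := right_ne_zero_of_mul (left_ne_zero_of_mul h)
  have hI := left_ne_zero_of_mul (left_ne_zero_of_mul h)
  refine Prod.ext (congrArg (wZero Φ - ·) ?_) (congrArg ((E : ℂ) - ·) ?_)
  all_goals
    simp only [corrDenom, Theta, etaVec] at hAₗ hAᵣ hI ⊢
    field_simp

theorem exists_norm_thetaInverse_le (hV : Continuous V) (hE : 0 < E) (hw : (wZero Φ).im = 0)
    (h : IsDichotomyPair V E κ B (uSol V Φ (etaVec Φ E)) (vSol V Φ (etaVec Φ E))) :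
    ∃ K, 0 ≤ K ∧ ∀ M, 1 ≤ M → ∀ g,
      ‖thetaInverse V Φ E M g‖ ≤ K * (Real.exp (-κ * M) * ‖g‖) := by
  obtain ⟨c, hc, hle⟩ := exists_exp_le_mul_norm_defect_vSol hV hE hw h
  obtain ⟨c', hc', hle'⟩ := exists_le_norm_uSqInt (E := E) hV hw
  have := h.pos
  refine ⟨2 * (B ^ 2 / (2 * κ) + 1) / c' * c, by positivity, fun M hM g => ?_⟩
  have hM0 : 0 ≤ M := zero_le_one.trans hM
  have norm_le {b A : ℂ} (hb : ‖b‖ ≤ ‖g‖) (hA : Real.exp (κ * M) ≤ c * ‖A‖) :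
      ‖b‖ ≤ c * (Real.exp (-κ * M) * ‖g‖) * ‖A‖ :=
    calc ‖b‖ ≤ Real.exp (-κ * M) * Real.exp (κ * M) * ‖g‖ := by
          rwa [← Real.exp_add, neg_mul, neg_add_cancel, Real.exp_zero, one_mul]
      _ ≤ Real.exp (-κ * M) * (c * ‖A‖) * ‖g‖ := by gcongr
      _ = _ := by ring
  rw [mul_assoc]
  exact norm_linearizedInverse_le hc' (uSqInt_add_uSqInt hV (-M) 0 M ▸ hle' M hM)
    (h.norm_integral_sq_le hM0) (h.norm_integral_neg_sq_le hM0) (by positivity)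
    (norm_le (norm_fst_le g) (hle M hM0).1) (norm_le (norm_snd_le g) (hle M hM0).2)

theorem exists_norm_theta_sub_sub_linear_le (hV : Continuous V) (hE : 0 < E)
    (hw : (wZero Φ).im = 0)
    (h : IsDichotomyPair V E κ B (uSol V Φ (etaVec Φ E)) (vSol V Φ (etaVec Φ E))) :
    ∃ C, 0 ≤ C ∧ ∃ ε, 0 < ε ∧ ∀ M r : ℝ, 1 ≤ M → 0 ≤ r → M * r ≤ ε →
      ∀ x y : ℂ × ℂ, ‖x - etaVec Φ E‖ ≤ r → ‖y - etaVec Φ E‖ ≤ r →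
        ‖Theta V Φ M x - Theta V Φ M y
            - (outPlus E (vSol V Φ (etaVec Φ E)) M
                * ((x - y).1 - (x - y).2 * uSqInt V Φ E 0 M),
              outMinus E (vSol V Φ (etaVec Φ E)) M
                * ((x - y).1 + (x - y).2 * uSqInt V Φ E (-M) 0))‖
          ≤ C * (M * (Real.exp (-κ * M) + r * Real.exp (κ * M))) * ‖x - y‖ := by
  have hpert := isPerturbation_uSol hV Φ (η := etaVec Φ E) (one_add_wZero_sq_ne_zero hw)
  obtain ⟨Cᵣ, hCᵣ, εᵣ, hεᵣ, hright⟩ := h.exists_norm_outPlus_sub_sub_linear_le hE _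
  obtain ⟨Cₗ, hCₗ, εₗ, hεₗ, hleft⟩ := h.exists_norm_outMinus_sub_sub_linear_le hE _
  refine ⟨2 * (Cᵣ + Cₗ), by positivity, min εᵣ εₗ, lt_min hεᵣ hεₗ,
    fun M r hM hr hMr x y hx hy => ?_⟩
  have : 0 ≤ M := zero_le_one.trans hM
  have hsum : ‖(x - y).1‖ + ‖(x - y).2‖ ≤ 2 * ‖x - y‖ := by
    linarith [norm_fst_le (x - y), norm_snd_le (x - y)]
  have hcancel : x.1 - (etaVec Φ E).1 - (y - etaVec Φ E).1 = (x - y).1 :=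
    sub_sub_sub_cancel_right _ _ _
  have hright := hright M r hM hr (hMr.trans (min_le_left _ _)) _ _ _ _ _ _
    ((norm_snd_le _).trans hx) ((norm_snd_le _).trans hy) ((norm_fst_le _).trans hy)
    (hpert x) (hpert y)
  have hleft := hleft M r hM hr (hMr.trans (min_le_right _ _)) _ _ _ _ _ _
    ((norm_snd_le _).trans hx) ((norm_snd_le _).trans hy) ((norm_fst_le _).trans hy)
    (hpert x) (hpert y)
  rw [hcancel] at hright hleft
  have enlarge {C : ℝ} (hle : C ≤ Cᵣ + Cₗ) :
      C * (M * (Real.exp (-κ * M) + r * Real.exp (κ * M))) * (‖(x - y).1‖ + ‖(x - y).2‖)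
        ≤ 2 * (Cᵣ + Cₗ) * (M * (Real.exp (-κ * M) + r * Real.exp (κ * M))) * ‖x - y‖ :=
    calc _ ≤ (Cᵣ + Cₗ) * (M * (Real.exp (-κ * M) + r * Real.exp (κ * M))) * (2 * ‖x - y‖) := by
          gcongr
      _ = _ := by ring
  exact max_le (hright.trans (enlarge (by linarith)))
    (hleft.trans (enlarge (by linarith)))

theorem exists_norm_thetaInverse_sub_sub_le (hV : Continuous V) (hE : 0 < E)
    (hw : (wZero Φ).im = 0)
    (h : IsDichotomyPair V E κ B (uSol V Φ (etaVec Φ E)) (vSol V Φ (etaVec Φ E))) :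
    ∃ C, 0 ≤ C ∧ ∃ ε, 0 < ε ∧ ∀ M r : ℝ, 1 ≤ M → 0 ≤ r → M * r ≤ ε →
      ∀ x y : ℂ × ℂ, ‖x - etaVec Φ E‖ ≤ r → ‖y - etaVec Φ E‖ ≤ r →
        ‖thetaInverse V Φ E M (Theta V Φ M x - Theta V Φ M y) - (x - y)‖
          ≤ C * (M * (Real.exp (-(2 * κ * M)) + r)) * ‖x - y‖ := by
  obtain ⟨K, hK, hinv⟩ := exists_norm_thetaInverse_le hV hE hw h
  obtain ⟨C, hC, ε, hε, hlinear⟩ := exists_norm_theta_sub_sub_linear_le hV hE hw h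
  refine ⟨K * C, by positivity, ε, hε, fun M r hM hr hMr x y hx hy => ?_⟩
  rw [← thetaInverse_linearized hV (corrDenom_ne_zero hV hE hw h hM) (x - y), ← map_sub,
    thetaInverse_linearized hV (corrDenom_ne_zero hV hE hw h hM) (x - y)]
  calc _ ≤ K * (Real.exp (-κ * M)
          * (C * (M * (Real.exp (-κ * M) + r * Real.exp (κ * M))) * ‖x - y‖)) :=
        (hinv M hM _).trans (by gcongr; exact hlinear M r hM hr hMr x y hx hy)
    _ = K * C * (M * (Real.exp (-κ * M) * Real.exp (-κ * M)
          + r * (Real.exp (-κ * M) * Real.exp (κ * M)))) * ‖x - y‖ := by ring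
    _ = _ := by
      rw [← Real.exp_add, ← Real.exp_add, show -κ * M + κ * M = 0 by ring,
        show -κ * M + -κ * M = -(2 * κ * M) by ring, Real.exp_zero, mul_one]

theorem exists_norm_thetaInverse_theta_etaVec_le (hV : Continuous V) (hE : 0 < E)
    (hw : (wZero Φ).im = 0)
    (h : IsDichotomyPair V E κ B (uSol V Φ (etaVec Φ E)) (vSol V Φ (etaVec Φ E))) :
    ∃ C, 0 ≤ C ∧ ∀ M, 1 ≤ M →
      ‖thetaInverse V Φ E M (Theta V Φ M (etaVec Φ E))‖ ≤ C * Real.exp (-(2 * κ * M)) := by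
  obtain ⟨K, hK, hinv⟩ := exists_norm_thetaInverse_le hV hE hw h
  have := h.bound_nonneg
  refine ⟨K * ((1 + Real.sqrt E) * B), by positivity, fun M hM => ?_⟩
  have hM0 : 0 ≤ M := zero_le_one.trans hM
  have hΘ : ‖Theta V Φ M (etaVec Φ E)‖ ≤ (1 + Real.sqrt E) * B * Real.exp (-κ * M) :=
    max_le (h.norm_outPlus_left_le hE.le hM0) (h.norm_outMinus_left_le hE.le hM0)
  calc _ ≤ K * (Real.exp (-κ * M) * ((1 + Real.sqrt E) * B * Real.exp (-κ * M))) :=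
        (hinv M hM _).trans (by gcongr)
    _ = K * ((1 + Real.sqrt E) * B) * (Real.exp (-κ * M) * Real.exp (-κ * M)) := by ring
    _ = _ := by rw [← Real.exp_add, show -κ * M + -κ * M = -(2 * κ * M) by ring]

end ThetaInverse

/-! ### The zero of `Θ` -/

/-- The Euclidean radius of the ball `Ω_M` in which the zero of `Θ` is sought. -/
noncomputable def omegaRadius (k M : ℝ) : ℝ := 1 / M ^ 2 * Real.exp (-(k * M))

section OmegaBall

variable {Φ : ℝ → ℂ} {E k κ M : ℝ} {ζ : ℂ × ℂ}

theorem omegaRadius_nonneg (k M : ℝ) : 0 ≤ omegaRadius k M := by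
  unfold omegaRadius
  positivity

theorem isClosed_omegaBall (Φ : ℝ → ℂ) (E k M : ℝ) : IsClosed (OmegaBall Φ E k M) :=
  isClosed_le (by fun_prop) continuous_const

theorem mem_omegaBall_of_norm_le (h : ‖ζ - etaVec Φ E‖ ≤ omegaRadius k M / 2) :
    ζ ∈ OmegaBall Φ E k M := by
  have hfst : ‖ζ.1 - (etaVec Φ E).1‖ ≤ _ := (norm_fst_le (ζ - etaVec Φ E)).trans h
  have hsnd : ‖ζ.2 - (etaVec Φ E).2‖ ≤ _ := (norm_snd_le (ζ - etaVec Φ E)).trans h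
  refine Real.sqrt_le_iff.2 ⟨omegaRadius_nonneg k M, ?_⟩
  change _ ≤ omegaRadius k M ^ 2
  nlinarith [pow_le_pow_left₀ (norm_nonneg _) hfst 2, pow_le_pow_left₀ (norm_nonneg _) hsnd 2]

theorem norm_le_of_mem_omegaBall (h : ζ ∈ OmegaBall Φ E k M) :
    ‖ζ - etaVec Φ E‖ ≤ omegaRadius k M :=
  max_le ((Real.le_sqrt_of_sq_le (le_add_of_nonneg_right (sq_nonneg _))).trans h)
    ((Real.le_sqrt_of_sq_le (le_add_of_nonneg_left (sq_nonneg _))).trans h)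

theorem re_snd_pos_of_norm_sub_etaVec_lt (h : ‖ζ - etaVec Φ E‖ < E) : 0 < ζ.2.re := by
  have hre : |(ζ.2 - (E : ℂ)).re| < E :=
    (Complex.abs_re_le_norm _).trans_lt ((norm_snd_le (ζ - etaVec Φ E)).trans_lt h)
  rw [Complex.sub_re, Complex.ofReal_re, abs_lt] at hre
  linarith

theorem tendsto_mul_omegaRadius (hk : 0 ≤ k) :
    Filter.Tendsto (fun M => M * omegaRadius k M) Filter.atTop (nhds 0) := by
  refine squeeze_zero' (g := fun M => M⁻¹) ?_ ?_ tendsto_inv_atTop_zero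
  · filter_upwards [Filter.eventually_ge_atTop 0] with M hM
    exact mul_nonneg hM (omegaRadius_nonneg k M)
  · filter_upwards [Filter.eventually_gt_atTop 0] with M hM
    calc M * omegaRadius k M = M⁻¹ * Real.exp (-(k * M)) := by
          unfold omegaRadius
          field_simp
      _ ≤ M⁻¹ := mul_le_of_le_one_right (by positivity)
          (Real.exp_le_one_iff.2 (neg_nonpos.2 (by positivity)))

theorem tendsto_exp_div_omegaRadius (hk : k < 2 * κ) :
    Filter.Tendsto (fun M => Real.exp (-(2 * κ * M)) / omegaRadius k M) Filter.atTop (nhds 0) := by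
  refine (tendsto_rpow_mul_exp_neg_mul_atTop_nhds_zero 2 (2 * κ - k) (sub_pos.2 hk)).congr
    fun M => ?_
  rw [omegaRadius, one_div, ← div_div, div_inv_eq_mul, mul_comm (Real.exp _), mul_div_assoc,
    ← Real.exp_sub, Real.rpow_ofNat]
  ring_nf

theorem eventually_newton_conditions (hκ : 0 < κ) (hk : 0 ≤ k) (hkκ : k ≤ κ) (C : ℝ) {ε : ℝ}
    (hε : 0 < ε) :
    ∀ᶠ M in Filter.atTop, 1 ≤ M ∧ M * omegaRadius k M ≤ ε ∧
      C * (M * (Real.exp (-(2 * κ * M)) + omegaRadius k M)) ≤ 1 / 4 ∧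
      C * Real.exp (-(2 * κ * M)) ≤ omegaRadius k M / 4 := by
  have hradius := tendsto_mul_omegaRadius hk
  have hexp : Filter.Tendsto (fun M => M * Real.exp (-(2 * κ * M))) Filter.atTop (nhds 0) :=
    (tendsto_rpow_mul_exp_neg_mul_atTop_nhds_zero 1 (2 * κ) (by positivity)).congr fun M => by
      rw [Real.rpow_one, neg_mul]
  have hsum := (hexp.add hradius).const_mul C
  have hratio := (tendsto_exp_div_omegaRadius (κ := κ) (k := k) (by linarith)).const_mul C
  rw [add_zero, mul_zero] at hsum
  rw [mul_zero] at hratio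
  filter_upwards [Filter.eventually_ge_atTop 1, hradius.eventually_le_const hε,
    hsum.eventually_le_const (show (0 : ℝ) < 1 / 4 by norm_num),
    hratio.eventually_le_const (show (0 : ℝ) < 1 / 4 by norm_num)] with M hM hMε hM_sum hM_ratio
  refine ⟨hM, hMε, by rwa [mul_add], ?_⟩
  have : 0 < omegaRadius k M := by
    unfold omegaRadius
    positivity
  rw [← mul_div_assoc, div_le_iff₀ this] at hM_ratio
  linarith

theorem mul_exp_le_mul_exp (hk : k < κ) :
    M * Real.exp (-(4 * κ * M)) ≤ 1 / (4 * (κ - k)) * Real.exp (-(4 * k * M)) := by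
  have hgap : 0 < 4 * (κ - k) := by linarith
  have hM : M ≤ 1 / (4 * (κ - k)) * Real.exp (4 * (κ - k) * M) := by
    rw [one_div, le_inv_mul_iff₀ hgap]
    linarith [Real.add_one_le_exp (4 * (κ - k) * M)]
  calc _ ≤ 1 / (4 * (κ - k)) * Real.exp (4 * (κ - k) * M) * Real.exp (-(4 * κ * M)) := by gcongr
    _ = _ := by rw [mul_assoc, ← Real.exp_add]; ring_nf

end OmegaBall

section Main

variable {V : ℝ → ℝ} {Φ : ℝ → ℂ} {E κ B k : ℝ}

theorem exists_norm_sub_approx_le (hV : Continuous V) (hE : 0 < E) (hw : (wZero Φ).im = 0)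
    (h : IsDichotomyPair V E κ B (uSol V Φ (etaVec Φ E)) (vSol V Φ (etaVec Φ E))) :
    ∃ ε, 0 < ε ∧ ∀ D, 0 ≤ D → ∃ C, 0 ≤ C ∧ ∀ M, 1 ≤ M → ∀ ζ, Theta V Φ M ζ = 0 →
      M * ‖ζ - etaVec Φ E‖ ≤ ε → ‖ζ - etaVec Φ E‖ ≤ D * Real.exp (-(2 * κ * M)) →
      ‖ζ - (wApprox V Φ E M, zApprox V Φ E M)‖ ≤ C * (M * Real.exp (-(4 * κ * M))) := by
  obtain ⟨C, hC, ε, hε, hnewton⟩ := exists_norm_thetaInverse_sub_sub_le hV hE hw h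
  refine ⟨ε, hε, fun D hD => ⟨C * (1 + D) * D, by positivity, fun M hM ζ hζ hMε hle => ?_⟩⟩
  have hremainder : ζ - (wApprox V Φ E M, zApprox V Φ E M)
      = -(thetaInverse V Φ E M (Theta V Φ M ζ - Theta V Φ M (etaVec Φ E))
          - (ζ - etaVec Φ E)) := by
    rw [approx_eq_sub_thetaInverse hV (corrDenom_ne_zero hV hE hw h hM), hζ, map_sub, map_zero]
    abel
  rw [hremainder, norm_neg]
  calc _ ≤ C * (M * (Real.exp (-(2 * κ * M)) + ‖ζ - etaVec Φ E‖)) * ‖ζ - etaVec Φ E‖ :=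
        hnewton M _ hM (norm_nonneg _) hMε ζ _ le_rfl (by rw [sub_self, norm_zero]; positivity)
    _ ≤ C * (M * (Real.exp (-(2 * κ * M)) + D * Real.exp (-(2 * κ * M))))
          * (D * Real.exp (-(2 * κ * M))) := by gcongr
    _ = C * (1 + D) * D * (M * (Real.exp (-(2 * κ * M)) * Real.exp (-(2 * κ * M)))) := by ring
    _ = _ := by
      rw [← Real.exp_add, show -(2 * κ * M) + -(2 * κ * M) = -(4 * κ * M) by ring]

theorem exists_eventually_theta_eq_zero (hV : Continuous V) (hE : 0 < E)
    (hw : (wZero Φ).im = 0)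
    (h : IsDichotomyPair V E κ B (uSol V Φ (etaVec Φ E)) (vSol V Φ (etaVec Φ E)))
    (hk : 0 ≤ k) (hkκ : k ≤ κ) :
    ∃ C, 0 ≤ C ∧ ∀ᶠ M in Filter.atTop, ∃ ζ ∈ OmegaBall Φ E k M, Theta V Φ M ζ = 0 ∧
      (∀ ξ ∈ OmegaBall Φ E k M, Theta V Φ M ξ = 0 → ξ = ζ) ∧ 0 < ζ.2.re ∧
      ‖ζ - (wApprox V Φ E M, zApprox V Φ E M)‖ ≤ C * (M * Real.exp (-(4 * κ * M))) := by
  obtain ⟨C₁, -, ε₁, hε₁, hnewton⟩ := exists_norm_thetaInverse_sub_sub_le hV hE hw h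
  obtain ⟨C₂, hC₂, hstart⟩ := exists_norm_thetaInverse_theta_etaVec_le hV hE hw h
  obtain ⟨ε₂, hε₂, happrox⟩ := exists_norm_sub_approx_le hV hE hw h
  obtain ⟨C₃, hC₃, happrox⟩ := happrox (2 * C₂) (by positivity)
  refine ⟨C₃, hC₃, ?_⟩
  filter_upwards [eventually_newton_conditions h.pos hk hkκ C₁ hε₁,
    eventually_newton_conditions h.pos hk hkκ C₂ hε₂,
    (tendsto_mul_omegaRadius hk).eventually_lt_const hE]
    with M ⟨hM, hMε₁, hcontr, _⟩ ⟨_, hMε₂, _, hsmall⟩ hME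
  have hclose := fun ζ => norm_le_of_mem_omegaBall (Φ := Φ) (E := E) (k := k) (M := M) (ζ := ζ)
  have hinverse := hstart M hM
  obtain ⟨ζ, hζ, hroot, hdist, hunique⟩ := exists_unique_zero_of_approx_inverse
    (thetaInverse_injective hV (corrDenom_ne_zero hV hE hw h hM)) (isClosed_omegaBall Φ E k M)
    (fun _ => mem_omegaBall_of_norm_le) hclose
    (fun x hx y hy => (hnewton M _ hM (omegaRadius_nonneg k M) hMε₁ x y (hclose x hx)
      (hclose y hy)).trans (by gcongr)) (hinverse.trans hsmall)
  have hMζ : M * ‖ζ - etaVec Φ E‖ ≤ M * omegaRadius k M := by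
    gcongr
    exact hclose ζ hζ
  refine ⟨ζ, hζ, hroot, hunique, re_snd_pos_of_norm_sub_etaVec_lt (Φ := Φ) (E := E) ?_,
    happrox M hM ζ hroot (hMζ.trans hMε₂) (by linarith)⟩
  linarith [le_mul_of_one_le_left (norm_nonneg (ζ - etaVec Φ E)) hM]

end Main

theorem mainTheorem5_general {V W : ℝ → ℝ} {ρ : ℝ} (hV : Continuous V)
    (hVW : ∀ x, ρ < |x| → V x = W x) (hW : Function.Periodic W 1) {E : ℝ} (hE : 0 < E)
    {Φ : ℝ → ℂ} (hΦ : IsBoundState V E Φ)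
    (hΦ_norm : Φ 0 = 1 ∨ (Φ 0 = 0 ∧ deriv Φ 0 = 1)) :
    ∃ κ : ℝ, IsFloquetExponent W E κ ∧
      ∀ k : ℝ, 0 < k → k ≤ κ →
        ∃ M₀ : ℝ, ρ < M₀ ∧ ∃ C : ℝ, 0 < C ∧ ∀ M : ℝ, M₀ ≤ M →
          corrDenom V Φ E M ≠ 0 ∧
          ∃ wstar zstar : ℂ,
            (wstar, zstar) ∈ OmegaBall Φ E k M ∧
            Theta V Φ M (wstar, zstar) = 0 ∧
            (∀ ζ ∈ OmegaBall Φ E k M, Theta V Φ M ζ = 0 → ζ = (wstar, zstar)) ∧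
            IsResonance V M zstar ∧
            ‖wstar - wApprox V Φ E M‖ ≤ C * (M * Real.exp (-(4 * κ * M))) ∧
            ‖zstar - zApprox V Φ E M‖ ≤ C * (M * Real.exp (-(4 * κ * M))) ∧
            (k < κ →
              ‖wstar - wApprox V Φ E M‖ ≤ C * Real.exp (-(4 * k * M)) ∧
              ‖zstar - zApprox V Φ E M‖ ≤ C * Real.exp (-(4 * k * M))) := by
  obtain ⟨κ, hκ, hw, B, hpair⟩ := hΦ.exists_isDichotomyPair hV hVW hW hΦ_norm
  refine ⟨κ, hκ, fun k hk hkκ => ?_⟩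
  obtain ⟨C, hC, hroot⟩ := exists_eventually_theta_eq_zero hV hE hw hpair hk.le hkκ
  obtain ⟨M₀, hM₀⟩ := Filter.eventually_atTop.1 (hroot.and (Filter.eventually_ge_atTop 1))
  have hgap : 0 ≤ 1 / (4 * (κ - k)) := one_div_nonneg.2 (by linarith)
  refine ⟨max M₀ (ρ + 1), lt_max_of_lt_right (lt_add_one ρ), C * (1 + 1 / (4 * (κ - k))) + 1,
    by positivity, fun M hM => ?_⟩
  obtain ⟨⟨⟨w, z⟩, hmem, hzero, hunique, hre, hdist⟩, hM1⟩ := hM₀ M ((le_max_left _ _).trans hM)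
  have hMpos : 0 < M := one_pos.trans_le hM1
  have hMκ : ‖(w, z) - (wApprox V Φ E M, zApprox V Φ E M)‖
      ≤ (C * (1 + 1 / (4 * (κ - k))) + 1) * (M * Real.exp (-(4 * κ * M))) :=
    hdist.trans (by gcongr; nlinarith)
  have hMk (hlt : k < κ) : ‖(w, z) - (wApprox V Φ E M, zApprox V Φ E M)‖
      ≤ (C * (1 + 1 / (4 * (κ - k))) + 1) * Real.exp (-(4 * k * M)) :=
    calc _ ≤ C * (1 / (4 * (κ - k)) * Real.exp (-(4 * k * M))) :=
          hdist.trans (mul_le_mul_of_nonneg_left (mul_exp_le_mul_exp hlt) hC)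
      _ ≤ _ := by rw [← mul_assoc]; gcongr; linarith
  exact ⟨corrDenom_ne_zero hV hE hw hpair hM1, w, z, hmem, hzero, hunique,
    isResonance_of_theta_eq_zero hV hMpos hre hzero, (norm_fst_le _).trans hMκ,
    (norm_snd_le _).trans hMκ,
    fun hlt => ⟨(norm_fst_le _).trans (hMk hlt), (norm_snd_le _).trans (hMk hlt)⟩⟩

theorem mainTheorem5
    (V Vper Vdef : ℝ → ℝ) (ρ : ℝ) (hρ : 0 ≤ ρ)
    (hV_smooth : ContDiff ℝ ∞ V)
    (hV_sum : ∀ x : ℝ, V x = Vper x + Vdef x)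
    (hV_per : ∀ x : ℝ, Vper (x + 1) = Vper x)
    (hV_def : ∀ x : ℝ, ρ < |x| → Vdef x = 0)
    (E : ℝ) (hE : 0 < E)
    (Φ : ℝ → ℂ) (hΦ : IsBoundState V E Φ)
    (hΦ_norm : Φ 0 = 1 ∨ (Φ 0 = 0 ∧ deriv Φ 0 = 1)) :
    ∃ κ : ℝ, IsFloquetExponent Vper E κ ∧
      ∀ k : ℝ, 0 < k → k ≤ κ →
        ∃ M₀ : ℝ, ρ < M₀ ∧ ∃ C : ℝ, 0 < C ∧ ∀ M : ℝ, M₀ ≤ M →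
          corrDenom V Φ E M ≠ 0 ∧
          ∃ wstar zstar : ℂ,
            (wstar, zstar) ∈ OmegaBall Φ E k M ∧
            Theta V Φ M (wstar, zstar) = 0 ∧
            (∀ ζ ∈ OmegaBall Φ E k M, Theta V Φ M ζ = 0 → ζ = (wstar, zstar)) ∧
            IsResonance V M zstar ∧
            ‖wstar - wApprox V Φ E M‖ ≤ C * (M * Real.exp (-(4 * κ * M))) ∧
            ‖zstar - zApprox V Φ E M‖ ≤ C * (M * Real.exp (-(4 * κ * M))) ∧
            (k < κ →
              ‖wstar - wApprox V Φ E M‖ ≤ C * Real.exp (-(4 * k * M)) ∧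
              ‖zstar - zApprox V Φ E M‖ ≤ C * Real.exp (-(4 * k * M))) :=
  mainTheorem5_general hV_smooth.continuous
    (fun x hx => by rw [hV_sum, hV_def x hx, add_zero]) hV_per hE hΦ hΦ_norm
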